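/- Let $G$ be the group of monotone bijections of $\mathbb{Q}$. Let $A$ and $B$ be $G$-sets, each with an arbitrary linear order on its set of orbits. An orbit-finite nominal set in a $G$-set is a $G$-invariant subset $X$ with finitely many orbits in which every element $x$ has a finite support, i.e. a finite $S\subseteq\mathbb{Q}$ such that every $g\in G$ fixing $S$ pointwise fixes $x$. Write $N(X)$ for its number of orbits, $\dim(x)$ for the size of the least support of $x$ and $\dim(X)=\max_{x\in X}\dim(x)$ (with $\dim(\emptyset)=0$). **Representation.** $X$ is stored as the number $N(X)$ together with a binary search tree that has exactly one node for each orbit of $X$, ordered by the order on orbits, and whose height is at most $2\log_2(N(X)+1)$ (this includes red-black and AVL trees). An orbit of a product $A\times B$ is represented by the triple $(O_1,O_2,P)$, where $O_1,O_2$ are its projections and $P\in\{L,R,B\}^*$ is the string obtained, for any $(x,y)$ in the orbit, by listing the union of the least supports of $x$ and $y$ in increasing order and writing $L$, $R$ or $B$ for an entry that is only in the least support of $x$, only in that of $y$, or in both; such triples are ordered lexicographically. **Cost model.** Programs are written in a first-order call-by-value functional language with recursion in which every evaluation step costs $1$. The primitive operations, each of cost $1$, are: truth values and natural-number constants; addition,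 truncated subtraction, halving and comparison of natural numbers; forming, taking apart and testing pairs and nil; comparing two orbits of the same $G$-set; constructing the orbit of an element; testing whether an element is in an orbit; extracting a sample element of an orbit; the dimension of an orbit; the empty string, and appending $k$ copies of a letter to a string; and one invocation of a user-defined function $p$ or $f$. Programs have no other access to elements and orbits. **Theorem.** There are fixed programs and a constant $C$, independent of $A$, $B$, the orders, $X$, $Y$, $p$ and $f$, such that for all orbit-finite nominal sets $X,Y$, all their representations as above as inputs, and all equivariant $p\colon X\to 2$ and $f\colon X\to B$ (with $2=\{0,1\}$ carrying the trivial action), the programs return the correct answer (a truth value for the two tests, and a representation as above of the resulting set otherwise) within $C\cdot(1+T)$ steps, where $T$ is as follows and $\log n$ denotes $\lfloor\log_2 n\rfloor$, with $\log 0=0$: * test $x\in X$ (for $x\in A$, $X\subseteq A$): $T=\log N(X)$; * test $X\subseteq Y$ (for $X,Y\subseteq A$): $T=\min\bigl(N(X)+N(Y),\ N(X)\log N(Y)\bigr)$; * calculate $X\cup Y$, and calculate $X\cap Y$ (for $X,Y\subseteq A$): $T=N(X)+N(Y)$; * calculate $\{x\in X\mid p(x)\}$ (for $X\subseteq A$):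 $T=N(X)$; * calculate $\{f(x)\mid x\in X\}$ (for $X\subseteq A$): $T=N(X)\log N(X)$; * calculate $X\times Y$ (for $X\subseteq A$, $Y\subseteq B$): $T=N(X\times Y)$. Moreover, in the last case $X\times Y$ is an orbit-finite nominal set and $N(X\times Y)\le 3^{\dim(X)+\dim(Y)}\,N(X)\,N(Y)$; in particular, the product takes $O\bigl(1+3^{\dim(X)+\dim(Y)}N(X)N(Y)\bigr)$ steps. -/

import Mathlib

/-! ## Nominal sets over the total order symmetry -/

/-- The group of monotone bijections of `ℚ`. Its product is composition, `(g * h) q = g (h q)`, so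
that its left actions are the right actions of the same group with the opposite product. -/
abbrev MonoAut : Type := ℚ ≃o ℚ

section Nominal

variable {A B : Type*} [MulAction MonoAut A] [MulAction MonoAut B]

/-- The finite set `S` is a support of `x`: each `g` that fixes every member of `S` fixes `x`. -/
def IsSupport (S : Finset ℚ) (x : A) : Prop :=
  ∀ g : MonoAut, (∀ q ∈ S, g q = q) → g • x = x

/-- A support of `x` that is contained in every (finite) support of `x`. -/
def IsLeastSupport (S : Finset ℚ) (x : A) : Prop :=
  IsSupport S x ∧ ∀ S' : Finset ℚ, IsSupport S' x → S ⊆ S'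

open Classical in
/-- The least support of `x` (it is unique when it exists; `∅` is a default value otherwise). -/
noncomputable def leastSupport (x : A) : Finset ℚ :=
  if h : ∃ S : Finset ℚ, IsLeastSupport S x then h.choose else ∅

/-- The dimension of an element. -/
noncomputable def dim (x : A) : ℕ := (leastSupport x).card

/-- The dimension of a set of elements, the maximum of the dimensions of its elements. -/
noncomputable def setDim (X : Set A) : ℕ := sSup (dim '' X)

variable (A) in
/-- The orbits of the action on `A`. -/
abbrev Orb : Type _ := MulAction.orbitRel.Quotient MonoAut A

/-- The orbit of an element. -/
def orbitOf (x : A) : Orb A := Quotient.mk (MulAction.orbitRel MonoAut A) x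

/-- The number of orbits that meet `X`. -/
noncomputable def numOrbits (X : Set A) : ℕ := (orbitOf '' X).ncard

/-- `X` is an orbit-finite nominal set, with the action inherited from `A`. -/
structure IsOrbitFiniteNominal (X : Set A) : Prop where
  equivariant : ∀ (g : MonoAut), ∀ x ∈ X, g • x ∈ X
  supported : ∀ x ∈ X, ∃ S : Finset ℚ, IsSupport S x
  orbitFinite : (orbitOf '' X).Finite

end Nominal

/-! ## Orbits of products -/

/-- The alphabet of the strings that relate the supports of the two components of a pair. -/
inductive Letter : Type
  | L
  | R
  | B

/-- The position of a letter in the order `L < R < B`. -/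
def Letter.rank : Letter → ℕ
  | .L => 0
  | .R => 1
  | .B => 2

theorem Letter.rank_injective : Function.Injective Letter.rank := by
  intro a b h
  cases a <;> cases b <;> simp_all [Letter.rank]

noncomputable instance : LinearOrder Letter := LinearOrder.lift' Letter.rank Letter.rank_injective

section Products

variable {A B : Type*} [MulAction MonoAut A] [MulAction MonoAut B]

open Classical in
/-- The string of a pair `(x, y)`. Go through `C = leastSupport x ∪ leastSupport y` in increasing
order, and write `L` for an atom that is only in the least support of `x`, `R` for one that is only
in the least support of `y`, and `B` for one that is in both. -/
noncomputable def pattern (x : A) (y : B) : List Letter :=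
  ((leastSupport x ∪ leastSupport y).sort (· ≤ ·)).map fun c =>
    if c ∈ leastSupport x then (if c ∈ leastSupport y then Letter.B else Letter.L) else Letter.R

variable (A B) in
/-- Representations of orbits of `A × B`: an orbit of `A`, an orbit of `B` and a string. They are
compared lexicographically, and the strings among themselves lexicographically too. -/
abbrev ProdOrb : Type _ := Orb A ×ₗ (Orb B ×ₗ List Letter)

/-- The representation of the orbit of a pair. -/
noncomputable def prodOrbitOf (z : A × B) : ProdOrb A B :=
  toLex (orbitOf z.1, toLex (orbitOf z.2, pattern z.1 z.2))

end Products

/-! ## Tree-based sets of orbits -/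

/-- The keys of a tree from left to right. -/
def inorder {K : Type*} : BinaryTree K → List K
  | .nil => []
  | .node k l r => inorder l ++ k :: inorder r

/-- `t` is a balanced binary search tree whose keys represent the orbits of `X`, each exactly once.
Here `code z` is the key that represents the orbit of `z`. The condition on the height `h` of a
tree with `n` nodes says that `h ≤ 2 * log₂ (n + 1)`; red-black trees and AVL trees satisfy it. -/
structure IsTreeOf {Z K : Type*} [MulAction MonoAut Z] [LinearOrder K] (code : Z → K)
    (X : Set Z) (t : BinaryTree K) : Prop where
  sorted : (inorder t).Pairwise (· < ·)
  balanced : 2 ^ t.height ≤ (t.numNodes + 1) ^ 2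
  keys : ∀ k, k ∈ inorder t ↔ ∃ z ∈ X, code z = k
  size : t.numNodes = numOrbits X

/-! ## A first-order functional language with a step count

Programs do not depend on the nominal sets they are run on: they see orbits and elements as
atoms, which they can only pass to the primitive operations below. -/

/-- Run-time values: truth values, numbers, strings, elements and orbits of two sets with an
action, and binary cells from which all data structures are built. -/
inductive Val (A B : Type*) [MulAction MonoAut A] [MulAction MonoAut B] : Type _
  | bool (b : Bool)
  | num (n : ℕ)
  | word (w : List Letter)
  | eltA (x : A)
  | eltB (y : B)
  | orbA (o : Orb A)
  | orbB (o : Orb B)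
  | nil
  | pair (v w : Val A B)

/-- The primitive operations. Each of them takes one step. -/
inductive Prim : Type
  -- truth values and numbers
  | lit (b : Bool)
  | const (k : ℕ)
  | add
  | sub
  | half
  | le
  -- cells
  | nil
  | pair
  | fst
  | snd
  | isNil
  -- construct an orbit from an element
  | orbitOf
  -- is this element in this orbit?
  | isElement
  -- a sample element of an orbit
  | getElement
  -- the dimension of an orbit
  | supportSize
  -- compare two orbits of the same set
  | orbLt
  -- the empty string
  | emptyWord
  -- append a given number of copies of a letter to a string
  | append (a : Letter)
  -- invoke the user-defined predicate on an element of the first set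
  | callPred
  -- invoke the user-defined function, from the first set to the second, on an element
  | callFn

/-- The user-defined functions that a program may invoke. They may be undefined for some
arguments, and a program that invokes them there has no result. -/
structure UserFns (A B : Type*) where
  pred : A → Option Bool
  fn : A → Option B

section Semantics

variable {A B : Type*} [MulAction MonoAut A] [MulAction MonoAut B]
  [LinearOrder (Orb A)] [LinearOrder (Orb B)]

open Classical in
/-- The result of a primitive operation; there is none if the arguments are not of the right
number and kind. -/
noncomputable def primResult (U : UserFns A B) : Prim → List (Val A B) → Option (Val A B)
  | .lit b, [] => some (.bool b)
  | .const k, [] => some (.num k)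
  | .add, [.num m, .num n] => some (.num (m + n))
  | .sub, [.num m, .num n] => some (.num (m - n))
  | .half, [.num m] => some (.num (m / 2))
  | .le, [.num m, .num n] => some (.bool (decide (m ≤ n)))
  | .nil, [] => some .nil
  | .pair, [v, w] => some (.pair v w)
  | .fst, [.pair v _] => some v
  | .snd, [.pair _ w] => some w
  | .isNil, [.nil] => some (.bool true)
  | .isNil, [.pair _ _] => some (.bool false)
  | .orbitOf, [.eltA x] => some (.orbA (_root_.orbitOf x))
  | .orbitOf, [.eltB y] => some (.orbB (_root_.orbitOf y))
  | .isElement, [.eltA x, .orbA o] => some (.bool (decide (_root_.orbitOf x = o)))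
  | .isElement, [.eltB y, .orbB o] => some (.bool (decide (_root_.orbitOf y = o)))
  | .getElement, [.orbA o] => some (.eltA (Quotient.out o))
  | .getElement, [.orbB o] => some (.eltB (Quotient.out o))
  | .supportSize, [.orbA o] => some (.num (dim (Quotient.out o)))
  | .supportSize, [.orbB o] => some (.num (dim (Quotient.out o)))
  | .orbLt, [.orbA o, .orbA o'] => some (.bool (decide (o < o')))
  | .orbLt, [.orbB o, .orbB o'] => some (.bool (decide (o < o')))
  | .emptyWord, [] => some (.word [])
  | .append a, [.word w, .num k] => some (.word (w ++ List.replicate k a))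
  | .callPred, [.eltA x] => (U.pred x).map .bool
  | .callFn, [.eltA x] => (U.fn x).map .eltB
  | _, _ => none

end Semantics

/-- Expressions. A variable is a position in the list of the values that are in scope, and `letE`
puts the value of its first expression in front of that list for its second expression. -/
inductive Expr : Type
  | var (i : ℕ)
  | op (p : Prim) (is : List ℕ)
  | call (f : ℕ) (is : List ℕ)
  | letE (e e' : Expr)
  | ite (i : ℕ) (e e' : Expr)

/-- A program: the bodies of finitely many functions, which may call each other recursively, and a
main expression. -/
structure Program : Type where
  funs : List Expr
  main : Expr

section Evaluation

variable {A B : Type*} [MulAction MonoAut A] [MulAction MonoAut B]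
  [LinearOrder (Orb A)] [LinearOrder (Orb B)]

/-- `Eval U F env e v n`: with the values `env` in scope, the call-by-value evaluation of `e` ends
with the value `v` after `n` steps. Every node of the evaluation counts as one step, the variables
in scope in a function body being the arguments of the call. -/
inductive Eval (U : UserFns A B) (F : List Expr) :
    List (Val A B) → Expr → Val A B → ℕ → Prop
  | var {env i v} (h : env[i]? = some v) : Eval U F env (.var i) v 1
  | op {env p is vs v} (hvs : List.Forall₂ (fun (i : ℕ) w => env[i]? = some w) is vs)
      (hv : primResult U p vs = some v) : Eval U F env (.op p is) v 1
  | call {env f is vs e v n} (hvs : List.Forall₂ (fun (i : ℕ) w => env[i]? = some w) is vs)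
      (hf : F[f]? = some e) (he : Eval U F vs e v n) : Eval U F env (.call f is) v (n + 1)
  | letE {env e e' v w m n} (he : Eval U F env e v m) (he' : Eval U F (v :: env) e' w n) :
      Eval U F env (.letE e e') w (m + n + 1)
  | iteTrue {env i e e' v n} (hi : env[i]? = some (.bool true)) (he : Eval U F env e v n) :
      Eval U F env (.ite i e e') v (n + 1)
  | iteFalse {env i e e' v n} (hi : env[i]? = some (.bool false)) (he : Eval U F env e' v n) :
      Eval U F env (.ite i e e') v (n + 1)

/-- On the given arguments, `P` stops with the result `v` after exactly `n` steps. -/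
def Runs (U : UserFns A B) (P : Program) (args : List (Val A B)) (v : Val A B) (n : ℕ) : Prop :=
  Eval U P.funs args P.main v n

/-- The result and the number of steps are determined by the expression and the values in scope. -/
theorem Eval.unique {U : UserFns A B} {F : List Expr} {env : List (Val A B)} {e : Expr}
    {v v' : Val A B} {n n' : ℕ} (h : Eval U F env e v n) (h' : Eval U F env e v' n') :
    v = v' ∧ n = n' := by
  have hread : ∀ {env : List (Val A B)} {is : List ℕ} {vs ws : List (Val A B)},
      List.Forall₂ (fun (i : ℕ) w => env[i]? = some w) is vs →
      List.Forall₂ (fun (i : ℕ) w => env[i]? = some w) is ws → vs = ws := by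
    intro env is vs ws h1
    induction h1 generalizing ws with
    | nil => intro h2; cases h2; rfl
    | cons ha _ ih =>
      intro h2
      cases h2 with
      | cons hb hb' =>
        rw [ih hb', Option.some.inj (ha.symm.trans hb)]
  induction h generalizing v' n' with
  | var h => cases h' with
    | var h' => exact ⟨Option.some.inj (h.symm.trans h'), rfl⟩
  | op hvs hv => cases h' with
    | op hvs' hv' =>
      rw [hread hvs hvs'] at hv
      exact ⟨Option.some.inj (hv.symm.trans hv'), rfl⟩
  | call hvs hf _ ih => cases h' with
    | call hvs' hf' he' =>
      rw [← hread hvs hvs', ← Option.some.inj (hf.symm.trans hf')] at he'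
      obtain ⟨h1, h2⟩ := ih he'
      exact ⟨h1, by rw [h2]⟩
  | letE _ _ ih1 ih2 => cases h' with
    | letE h1 h2 =>
      obtain ⟨rfl, rfl⟩ := ih1 h1
      obtain ⟨rfl, rfl⟩ := ih2 h2
      exact ⟨rfl, rfl⟩
  | iteTrue hi _ ih => cases h' with
    | iteTrue _ h2 => obtain ⟨rfl, rfl⟩ := ih h2; exact ⟨rfl, rfl⟩
    | iteFalse hi' _ => simp [hi] at hi'
  | iteFalse hi _ ih => cases h' with
    | iteTrue hi' _ => simp [hi] at hi'
    | iteFalse _ h2 => obtain ⟨rfl, rfl⟩ := ih h2; exact ⟨rfl, rfl⟩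

end Evaluation

/-! ## Trees as values -/

section Encoding

variable {A B : Type*} [MulAction MonoAut A] [MulAction MonoAut B]

/-- A tree as a value, when `e` turns its keys into values. -/
def treeVal {K : Type*} (e : K → Val A B) : BinaryTree K → Val A B
  | .nil => .nil
  | .node k l r => .pair (e k) (.pair (treeVal e l) (treeVal e r))

/-- A set of orbits as a value: the number of its orbits, together with the tree. -/
def setVal {K : Type*} (e : K → Val A B) (t : BinaryTree K) : Val A B :=
  .pair (.num t.numNodes) (treeVal e t)

/-- The representation of an orbit of a product as a value. -/
def prodOrbVal (k : ProdOrb A B) : Val A B :=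
  .pair (.orbA (ofLex k).1) (.pair (.orbB (ofLex (ofLex k).2).1) (.word (ofLex (ofLex k).2).2))

end Encoding

/-!
Why the theorem is true.

*Orbits of products.* By back-and-forth, a finite strictly monotone map extends to a monotone
bijection of `ℚ` (`exists_monoAut_eqOn`). Hence a member of one support of `x` that is missing from
another support can be removed from the first (`IsSupport.erase`), so supports are closed under
intersection and finitely supported elements have least supports, which are moved along by the
action. A pair `(x, y)` is then determined up to the action by the orbits of `x` and `y` and by the
relative position of the two least supports, which is what `pattern x y` records
(`orbitOf_eq_of_prodOrbitOf_eq`). Conversely every string with `dim x` letters `L` or `B` and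
`dim y` letters `R` or `B` occurs (`mem_image_prodOrbitOf`). There are at most `3 ^ (dim x + dim y)`
of these strings, and they are enumerated without dead ends by choosing one letter after the other
(`strings`), so that listing them takes a time linear in their number.

*Algorithms.* A tree is flattened to an increasing list in linear time, and a balanced tree is built
from an increasing list in linear time by halving (`evalsWithin_build`). Union, intersection and
filtering are merges and a filter in between. Membership is a search in the tree. For the
inclusion, the cheaper of a merge and of repeated searches is chosen by computing both bounds from
the stored sizes, after the cases have been settled in which even this would be too slow. The image
is sorted by merging along the given tree, whose height is logarithmic. The product is listed
directly in lexicographic order.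

All statements about programs have the form `EvalsWithin`, a result together with an upper bound on
the number of steps. They are proved by rules that follow the syntax, and the bounds by induction
along the recursion of the programs.
-/

/-! ### Extending finite monotone maps -/

/-- A strictly monotone map from a finite set of rationals extends to a monotone bijection of `ℚ`.
This is the back-and-forth construction, started from the given map. -/
theorem exists_monoAut_eqOn {S : Finset ℚ} {f : ℚ → ℚ} (hf : StrictMonoOn f S) :
    ∃ g : MonoAut, ∀ q ∈ S, g q = f q := by
  classical
  let start : Order.PartialIso ℚ ℚ := ⟨S.image fun q => (q, f q), by
    intro p hp q hq
    obtain ⟨a, ha, rfl⟩ := Finset.mem_image.1 hp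
    obtain ⟨b, hb, rfl⟩ := Finset.mem_image.1 hq
    exact (hf.cmp_map_eq ha hb).symm⟩
  let toCofinal : ℚ ⊕ ℚ → Order.Cofinal (Order.PartialIso ℚ ℚ) := fun p =>
    Sum.recOn p (Order.PartialIso.definedAtLeft ℚ) (Order.PartialIso.definedAtRight ℚ)
  let I : Order.Ideal (Order.PartialIso ℚ ℚ) := Order.idealOfCofinals start toCofinal
  let F a := Order.PartialIso.funOfIdeal a I
    (Order.cofinal_meets_idealOfCofinals _ toCofinal (Sum.inl a))
  let G b := Order.PartialIso.invOfIdeal b I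
    (Order.cofinal_meets_idealOfCofinals _ toCofinal (Sum.inr b))
  refine ⟨OrderIso.ofCmpEqCmp (fun a => (F a).val) (fun b => (G b).val) fun a b => ?_,
    fun q hq => ?_⟩
  · rcases (F a).prop with ⟨f, hf, ha⟩
    rcases (G b).prop with ⟨g, hg, hb⟩
    rcases I.directed _ hf _ hg with ⟨m, _, fm, gm⟩
    exact m.prop (a, _) (fm ha) (_, b) (gm hb)
  · change (F q).val = f q
    rcases (F q).prop with ⟨f', hf', ha⟩
    rcases I.directed _ hf' _ (Order.mem_idealOfCofinals start toCofinal) with ⟨m, _, fm, gm⟩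
    have h := m.prop _ (fm ha) (q, f q) (gm (Finset.mem_image_of_mem _ hq))
    exact (cmp_eq_eq_iff _ _).1 (h.symm.trans (cmp_self_eq_eq q))

/-- Two increasing lists of rationals of the same length are related by a monotone bijection. -/
theorem exists_monoAut_map_eq {l l' : List ℚ} (hl : l.Pairwise (· < ·)) (hl' : l'.Pairwise (· < ·))
    (hlen : l.length = l'.length) : ∃ g : MonoAut, l.map g = l' := by
  have hmono : StrictMonoOn (fun q => l'.getD (l.idxOf q) 0) (l.toFinset : Set ℚ) := by
    intro a ha b hb hab
    have ha : a ∈ l := by simpa using ha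
    have hb : b ∈ l := by simpa using hb
    have ha' := List.idxOf_lt_length_of_mem ha
    have hb' := List.idxOf_lt_length_of_mem hb
    have hlt : l.idxOf a < l.idxOf b := by
      by_contra hle
      rcases (not_lt.1 hle).eq_or_lt with h | h
      · have h1 := List.getElem_idxOf ha'
        have h2 := List.getElem_idxOf hb'
        simp only [h] at h2
        exact absurd (h1.symm.trans h2) hab.ne
      · have := List.pairwise_iff_getElem.1 hl _ _ hb' ha' h
        rw [List.getElem_idxOf, List.getElem_idxOf] at this
        exact lt_asymm hab this
    have := List.pairwise_iff_getElem.1 hl' _ _ (hlen ▸ ha') (hlen ▸ hb') hlt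
    simpa [List.getD_eq_getElem, ← hlen, ha', hb'] using this
  obtain ⟨g, hg⟩ := exists_monoAut_eqOn hmono
  refine ⟨g, List.ext_getElem (by simpa using hlen) fun i h1 h2 => ?_⟩
  have hi : i < l.length := by simpa using h1
  rw [List.getElem_map, hg _ (List.mem_toFinset.2 (List.getElem_mem hi)),
    List.Nodup.idxOf_getElem (hl.imp fun h => h.ne) i hi, List.getD_eq_getElem _ _ h2]

/-- A monotone bijection that fixes `S` and moves `p` to `p'`, two points in the same gap of `S`. -/
theorem exists_monoAut_move {S : Finset ℚ} {p p' : ℚ}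
    (h : ∀ s ∈ S, (s < p ∧ s < p') ∨ (p < s ∧ p' < s)) :
    ∃ g : MonoAut, (∀ s ∈ S, g s = s) ∧ g p = p' := by
  classical
  have hp : p ∉ S := fun hp => by rcases h p hp with h | h <;> exact lt_irrefl _ h.1
  have hmono : StrictMonoOn (Function.update id p p') (insert p S : Finset ℚ) := by
    intro a ha b hb hab
    simp only [Finset.coe_insert, Set.mem_insert_iff, Finset.mem_coe] at ha hb
    rcases ha with rfl | ha <;> rcases hb with rfl | hb
    · exact absurd hab (lt_irrefl _)
    · rw [Function.update_self, Function.update_of_ne hab.ne']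
      rcases h b hb with h | h
      · exact absurd hab h.1.not_gt
      · exact h.2
    · rw [Function.update_self, Function.update_of_ne hab.ne]
      rcases h a ha with h | h
      · exact h.2
      · exact absurd hab h.1.not_gt
    · rw [Function.update_of_ne (by rintro rfl; exact hp ha),
        Function.update_of_ne (by rintro rfl; exact hp hb)]
      exact hab
  obtain ⟨g, hg⟩ := exists_monoAut_eqOn hmono
  refine ⟨g, fun s hs => ?_, by simpa using hg p (Finset.mem_insert_self _ _)⟩
  rw [hg s (Finset.mem_insert_of_mem hs), Function.update_of_ne (by rintro rfl; exact hp hs)]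
  rfl

/-! ### Least supports -/

section Supports

variable {A B : Type*} [MulAction MonoAut A] [MulAction MonoAut B]

theorem IsSupport.mono {S T : Finset ℚ} {x : A} (h : IsSupport S x) (hST : S ⊆ T) :
    IsSupport T x :=
  fun g hg => h g fun q hq => hg q (hST hq)

/-- A point to the right of `q` that no member of a finite set separates from `q`. -/
theorem exists_gt_forall_lt (S : Finset ℚ) (q : ℚ) : ∃ p, q < p ∧ ∀ s ∈ S, q < s → p < s := by
  obtain ⟨p, h1, h2⟩ := Order.exists_between_finsets {q} (S.filter (q < ·)) (by simp)
  exact ⟨p, h1 q (by simp), fun s hs hqs => h2 s (by simp [hs, hqs])⟩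

theorem exists_lt_forall_lt (S : Finset ℚ) (q : ℚ) : ∃ p, p < q ∧ ∀ s ∈ S, s < q → s < p := by
  obtain ⟨p, h1, h2⟩ := Order.exists_between_finsets (S.filter (· < q)) {q} (by simp)
  exact ⟨p, h2 q (by simp), fun s hs hqs => h1 s (by simp [hs, hqs])⟩

/-- A member of a support that is missing from another support can be removed. An automorphism `g`
that fixes `S.erase q` is a product of three automorphisms each of which fixes `S` or `T`: one
that fixes `T` moves `q` a little towards `g q`, and one that fixes `S` moves it on to `g q`. -/
theorem IsSupport.erase {S T : Finset ℚ} {x : A} {q : ℚ} (hS : IsSupport S x) (hT : IsSupport T x)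
    (hqT : q ∉ T) : IsSupport (S.erase q) x := by
  classical
  intro g hg
  have side : ∀ s ∈ S.erase q, (s < q ∧ s < g q) ∨ (q < s ∧ g q < s) := by
    intro s hs
    rcases lt_or_gt_of_ne (Finset.ne_of_mem_erase hs) with h | h
    · exact .inl ⟨h, by simpa [hg s hs] using g.strictMono h⟩
    · exact .inr ⟨h, by simpa [hg s hs] using g.strictMono h⟩
  -- an automorphism fixing `T` and an automorphism fixing `S` whose product agrees with `g` at `q`
  obtain ⟨r, k, hrT, hrS, hkS, hkr⟩ : ∃ r k : MonoAut, (∀ s ∈ T, r s = s) ∧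
      (∀ s ∈ S.erase q, r s = s) ∧ (∀ s ∈ S, k s = s) ∧ k (r q) = g q := by
    rcases lt_trichotomy (g q) q with hlt | heq | hgt
    · obtain ⟨p, hpq, hp⟩ := exists_lt_forall_lt (S.erase q ∪ T) q
      obtain ⟨r, hr, hrq⟩ := exists_monoAut_move (S := S.erase q ∪ T) (p := q) (p' := p) (by
        intro s hs
        have hne : s ≠ q := by
          rintro rfl
          simp [hqT] at hs
        rcases lt_or_gt_of_ne hne with h | h
        · exact .inl ⟨h, hp s hs h⟩
        · exact .inr ⟨h, hpq.trans h⟩)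
      obtain ⟨k, hk, hkp⟩ := exists_monoAut_move (S := S) (p := p) (p' := g q) (by
        intro s hs
        by_cases hsq : s = q
        · subst hsq; exact .inr ⟨hpq, hlt⟩
        · have hs' := Finset.mem_erase.2 ⟨hsq, hs⟩
          rcases side s hs' with h | h
          · exact .inl ⟨hp s (Finset.mem_union_left _ hs') h.1, h.2⟩
          · exact .inr ⟨hpq.trans h.1, h.2⟩)
      exact ⟨r, k, fun s hs => hr s (Finset.mem_union_right _ hs),
        fun s hs => hr s (Finset.mem_union_left _ hs), hk, by rw [hrq, hkp]⟩
    · exact ⟨1, 1, by simp, by simp, by simp, by simp [heq]⟩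
    · obtain ⟨p, hpq, hp⟩ := exists_gt_forall_lt (S.erase q ∪ T) q
      obtain ⟨r, hr, hrq⟩ := exists_monoAut_move (S := S.erase q ∪ T) (p := q) (p' := p) (by
        intro s hs
        have hne : s ≠ q := by
          rintro rfl
          simp [hqT] at hs
        rcases lt_or_gt_of_ne hne with h | h
        · exact .inl ⟨h, h.trans hpq⟩
        · exact .inr ⟨h, hp s hs h⟩)
      obtain ⟨k, hk, hkp⟩ := exists_monoAut_move (S := S) (p := p) (p' := g q) (by
        intro s hs
        by_cases hsq : s = q
        · subst hsq; exact .inl ⟨hpq, hgt⟩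
        · have hs' := Finset.mem_erase.2 ⟨hsq, hs⟩
          rcases side s hs' with h | h
          · exact .inl ⟨h.1.trans hpq, h.2⟩
          · exact .inr ⟨hp s (Finset.mem_union_left _ hs') h.1, h.2⟩)
      exact ⟨r, k, fun s hs => hr s (Finset.mem_union_right _ hs),
        fun s hs => hr s (Finset.mem_union_left _ hs), hk, by rw [hrq, hkp]⟩
  have h1 : ((k * r)⁻¹ * g) • x = x := by
    refine hS _ fun s hs => ?_
    have hgs : g s = (k * r) s := by
      by_cases hsq : s = q
      · rw [hsq, ← hkr]; rfl
      · have hs' := Finset.mem_erase.2 ⟨hsq, hs⟩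
        rw [hg s hs', RelIso.mul_apply, hrS s hs', hkS s hs]
    rw [RelIso.mul_apply, hgs, RelIso.inv_apply_self]
  rw [mul_smul, inv_smul_eq_iff, mul_smul, hT r hrT, hS k hkS] at h1
  exact h1

theorem IsSupport.inter {S T : Finset ℚ} {x : A} (hS : IsSupport S x) (hT : IsSupport T x) :
    IsSupport (S ∩ T) x := by
  classical
  have key : ∀ D : Finset ℚ, Disjoint D T → IsSupport (S \ D) x := by
    intro D
    induction D using Finset.induction_on with
    | empty => intro _; simpa using hS
    | insert q D _ ih =>
      intro hD
      rw [Finset.disjoint_insert_left] at hD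
      rw [Finset.sdiff_insert]
      exact (ih hD.2).erase hT hD.1
  have := key (S \ T) Finset.sdiff_disjoint
  rwa [sdiff_sdiff_right_self] at this

theorem exists_isLeastSupport {x : A} (h : ∃ S : Finset ℚ, IsSupport S x) :
    ∃ S : Finset ℚ, IsLeastSupport S x := by
  classical
  -- a support of the least cardinality
  obtain ⟨S, hS, hmin⟩ := WellFounded.has_min (measure Finset.card).wf
    {S : Finset ℚ | IsSupport S x} h
  refine ⟨S, hS, fun T hT => ?_⟩
  have hcard := hmin _ (IsSupport.inter hS hT)
  have : S.card ≤ (S ∩ T).card := not_lt.1 hcard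
  exact Finset.inter_eq_left.1 (Finset.eq_of_subset_of_card_le Finset.inter_subset_left this)

theorem isLeastSupport_leastSupport {x : A} (h : ∃ S : Finset ℚ, IsSupport S x) :
    IsLeastSupport (leastSupport x) x := by
  rw [leastSupport, dif_pos (exists_isLeastSupport h)]
  exact (exists_isLeastSupport h).choose_spec

theorem IsLeastSupport.eq {S T : Finset ℚ} {x : A} (hS : IsLeastSupport S x)
    (hT : IsLeastSupport T x) : S = T :=
  (hS.2 T hT.1).antisymm (hT.2 S hS.1)

theorem IsSupport.smul {S : Finset ℚ} {x : A} (h : IsSupport S x) (g : MonoAut) :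
    IsSupport (S.map g.toEquiv.toEmbedding) (g • x) := by
  intro k hk
  have := h (g⁻¹ * k * g) fun q hq => by
    rw [RelIso.mul_apply, RelIso.mul_apply, hk (g q) (Finset.mem_map_of_mem _ hq),
      RelIso.inv_apply_self]
  rwa [mul_smul, mul_smul, inv_smul_eq_iff] at this

/-- Taking the least support is equivariant, also when there is none. -/
theorem leastSupport_smul (g : MonoAut) (x : A) :
    leastSupport (g • x) = (leastSupport x).map g.toEquiv.toEmbedding := by
  have back : ∀ (g : MonoAut) (S : Finset ℚ),
      (S.map (g⁻¹ : MonoAut).toEquiv.toEmbedding).map g.toEquiv.toEmbedding = S := by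
    intro g S
    ext q
    simp only [Finset.mem_map_equiv]
    have : (g⁻¹ : MonoAut).toEquiv.symm (g.toEquiv.symm q) = q :=
      g.apply_symm_apply q
    rw [this]
  by_cases h : ∃ S : Finset ℚ, IsSupport S x
  · have h' : ∃ S : Finset ℚ, IsSupport S (g • x) := h.imp' _ fun S hS => hS.smul g
    refine (isLeastSupport_leastSupport h').eq ⟨(isLeastSupport_leastSupport h).1.smul g, ?_⟩
    intro T hT
    have hT' := hT.smul g⁻¹
    rw [inv_smul_smul] at hT'
    have := Finset.map_subset_map (f := g.toEquiv.toEmbedding).2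
      ((isLeastSupport_leastSupport h).2 _ hT')
    rwa [back] at this
  · have h' : ¬ ∃ S : Finset ℚ, IsSupport S (g • x) := fun ⟨S, hS⟩ =>
      h ⟨_, by simpa using hS.smul g⁻¹⟩
    have none : ∀ y : A, (¬ ∃ S : Finset ℚ, IsSupport S y) → leastSupport y = ∅ := fun y hy =>
      dif_neg fun ⟨S, hS⟩ => hy ⟨S, hS.1⟩
    rw [none _ h, none _ h', Finset.map_empty]

theorem dim_smul (g : MonoAut) (x : A) : dim (g • x) = dim x := by
  rw [dim, leastSupport_smul, Finset.card_map, dim]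

theorem orbitOf_eq_iff {x y : A} : orbitOf x = orbitOf y ↔ ∃ g : MonoAut, g • y = x :=
  Quotient.eq (r := MulAction.orbitRel MonoAut A)

theorem orbitOf_smul (g : MonoAut) (x : A) : orbitOf (g • x) = orbitOf x :=
  orbitOf_eq_iff.2 ⟨g, rfl⟩

theorem orbitOf_out (o : Orb A) : orbitOf (Quotient.out o) = o := Quotient.out_eq o

theorem dim_eq_of_orbitOf_eq {x y : A} (h : orbitOf x = orbitOf y) : dim x = dim y := by
  obtain ⟨g, rfl⟩ := orbitOf_eq_iff.1 h
  exact dim_smul g y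

theorem IsOrbitFiniteNominal.mem_of_orbitOf_eq {X : Set A} (hX : IsOrbitFiniteNominal X) {x y : A}
    (hx : x ∈ X) (h : orbitOf y = orbitOf x) : y ∈ X := by
  obtain ⟨g, rfl⟩ := orbitOf_eq_iff.1 h
  exact hX.equivariant g x hx

theorem IsOrbitFiniteNominal.orbitOf_mem_image {X : Set A} (hX : IsOrbitFiniteNominal X) {x : A} :
    orbitOf x ∈ orbitOf '' X ↔ x ∈ X :=
  ⟨fun ⟨_, hy, h⟩ => hX.mem_of_orbitOf_eq hy h.symm, fun h => ⟨x, h, rfl⟩⟩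

theorem IsOrbitFiniteNominal.dim_le_setDim {X : Set A} (hX : IsOrbitFiniteNominal X) {x : A}
    (hx : x ∈ X) : dim x ≤ setDim X := by
  have hfin : (dim '' X).Finite := by
    refine (hX.orbitFinite.image fun o => dim (Quotient.out o)).subset ?_
    rintro _ ⟨y, hy, rfl⟩
    exact ⟨orbitOf y, ⟨y, hy, rfl⟩, dim_eq_of_orbitOf_eq (orbitOf_out _)⟩
  exact le_csSup hfin.bddAbove ⟨x, hx, rfl⟩

end Supports

/-! ### Patterns of pairs of supports -/

/-- Does the letter stand for an atom of the first support? -/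
def Letter.inLeft : Letter → Bool
  | .L => true
  | .R => false
  | .B => true

/-- Does the letter stand for an atom of the second support? -/
def Letter.inRight : Letter → Bool
  | .L => false
  | .R => true
  | .B => true

theorem Letter.ext_in {a b : Letter} (h : a.inLeft = b.inLeft) (h' : a.inRight = b.inRight) :
    a = b := by
  cases a <;> cases b <;> simp_all [inLeft, inRight]

/-- The letter of an atom of `S ∪ T`. -/
def letterOf (S T : Finset ℚ) (c : ℚ) : Letter :=
  if c ∈ S then (if c ∈ T then Letter.B else Letter.L) else Letter.R

/-- The string of a pair of finite sets of atoms: `pattern x y` is the string of the two least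
supports. -/
def supportPattern (S T : Finset ℚ) : List Letter :=
  ((S ∪ T).sort (· ≤ ·)).map (letterOf S T)

section Patterns

variable {S T S' T' : Finset ℚ}

theorem inLeft_letterOf (c : ℚ) : (letterOf S T c).inLeft = decide (c ∈ S) := by
  unfold letterOf; split_ifs <;> simp_all [Letter.inLeft]

theorem inRight_letterOf {c : ℚ} (hc : c ∈ S ∪ T) : (letterOf S T c).inRight = decide (c ∈ T) := by
  rw [Finset.mem_union] at hc
  unfold letterOf; split_ifs <;> simp_all [Letter.inRight]

theorem supportPattern_map (g : MonoAut) :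
    supportPattern (S.map g.toEquiv.toEmbedding) (T.map g.toEquiv.toEmbedding) =
      supportPattern S T := by
  have h : ((S ∪ T).sort (· ≤ ·)).map g = ((S ∪ T).map g.toEquiv.toEmbedding).sort (· ≤ ·) := by
    exact StrictMonoOn.map_finsetSort g.toEquiv.toEmbedding (S ∪ T) (g.strictMono.strictMonoOn _)
  rw [supportPattern, ← Finset.map_union, ← h, List.map_map, supportPattern]
  refine List.map_congr_left fun c _ => ?_
  have hmem : ∀ V : Finset ℚ, g c ∈ V.map g.toEquiv.toEmbedding ↔ c ∈ V := fun V =>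
    Finset.mem_map' g.toEquiv.toEmbedding
  simp only [Function.comp_apply, letterOf, hmem]

theorem length_supportPattern : (supportPattern S T).length = (S ∪ T).card := by
  simp [supportPattern]

theorem countP_sort {V W : Finset ℚ} (h : W ⊆ V) :
    (V.sort (· ≤ ·)).countP (fun c => decide (c ∈ W)) = W.card := by
  have h1 : (V.filter (· ∈ W)).card = W.card := by
    rw [Finset.filter_mem_eq_inter, Finset.inter_eq_right.2 h]
  rw [← h1, Finset.card_def, Finset.filter_val, ← Multiset.countP_eq_card_filter,
    ← Finset.sort_eq V (· ≤ ·), Multiset.coe_countP]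

theorem countP_inLeft_supportPattern : (supportPattern S T).countP Letter.inLeft = S.card := by
  rw [supportPattern, List.countP_map, ← countP_sort (Finset.subset_union_left (s₁ := S) (s₂ := T))]
  exact List.countP_congr fun c _ => by simp [inLeft_letterOf]

theorem countP_inRight_supportPattern : (supportPattern S T).countP Letter.inRight = T.card := by
  rw [supportPattern, List.countP_map,
    ← countP_sort (Finset.subset_union_right (s₁ := S) (s₂ := T))]
  refine List.countP_congr fun c hc => ?_
  rw [Function.comp_apply, inRight_letterOf (by simpa using hc)]

theorem eq_of_supportPattern_eq (h : supportPattern S T = supportPattern S' T')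
    (hU : S ∪ T = S' ∪ T') : S = S' ∧ T = T' := by
  rw [supportPattern, supportPattern, ← hU, List.map_inj_left] at h
  have h : ∀ c ∈ S ∪ T, letterOf S T c = letterOf S' T' c := fun c hc => h c (by simpa using hc)
  constructor
  · ext c
    by_cases hc : c ∈ S ∪ T
    · simpa [inLeft_letterOf] using congrArg Letter.inLeft (h c hc)
    · have hc' := hU ▸ hc
      simp only [Finset.mem_union, not_or] at hc hc'
      simp [hc.1, hc'.1]
  · ext c
    by_cases hc : c ∈ S ∪ T
    · have := congrArg Letter.inRight (h c hc)
      rw [inRight_letterOf hc, inRight_letterOf (hU ▸ hc)] at this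
      simpa using this
    · have hc' := hU ▸ hc
      simp only [Finset.mem_union, not_or] at hc hc'
      simp [hc.2, hc'.2]

/-- Every string is a pattern: its letters can be placed on the atoms `0, 1, 2, …`. -/
theorem exists_supportPattern_eq (w : List Letter) : ∃ S T, supportPattern S T = w := by
  classical
  let atoms : Finset ℚ := (Finset.range w.length).map Nat.castEmbedding
  have hsort : atoms.sort (· ≤ ·) = (List.range w.length).map (Nat.cast : ℕ → ℚ) := by
    rw [← Finset.sort_range]
    exact (StrictMonoOn.map_finsetSort Nat.castEmbedding _
      (Nat.strictMono_cast.strictMonoOn _)).symm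
  let part (p : Letter → Bool) : Finset ℚ :=
    ((Finset.range w.length).filter fun i => p (w.getD i .L)).map Nat.castEmbedding
  have hpart : ∀ (p : Letter → Bool) (i : ℕ) (hi : i < w.length),
      (i : ℚ) ∈ part p ↔ p w[i] = true := by
    intro p i hi
    simp [part, hi]
  have hunion : part Letter.inLeft ∪ part Letter.inRight = atoms := by
    rw [← Finset.map_union, ← Finset.filter_or]
    congr 1
    refine Finset.filter_true_of_mem fun i _ => ?_
    cases w.getD i .L <;> simp [Letter.inLeft, Letter.inRight]
  refine ⟨part Letter.inLeft, part Letter.inRight, ?_⟩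
  rw [supportPattern, hunion, hsort]
  refine List.ext_getElem (by simp) fun i h1 h2 => ?_
  simp only [List.getElem_map, List.getElem_range]
  have hmem : (i : ℚ) ∈ part Letter.inLeft ∪ part Letter.inRight := by
    rw [hunion]; simpa [atoms] using h2
  refine Letter.ext_in ?_ ?_
  · rw [inLeft_letterOf, Bool.eq_iff_iff, decide_eq_true_iff, hpart _ i h2]
  · rw [inRight_letterOf hmem, Bool.eq_iff_iff, decide_eq_true_iff, hpart _ i h2]

/-- The strings that describe pairs of supports of sizes `m` and `n`, in lexicographic order. -/
def strings : ℕ → ℕ → List (List Letter)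
  | 0, n => [List.replicate n .R]
  | m + 1, 0 => [List.replicate (m + 1) .L]
  | m + 1, n + 1 => (strings m (n + 1)).map (.L :: ·) ++ ((strings (m + 1) n).map (.R :: ·) ++
      (strings m n).map (.B :: ·))

theorem mem_strings {m n : ℕ} {w : List Letter} :
    w ∈ strings m n ↔ w.countP Letter.inLeft = m ∧ w.countP Letter.inRight = n := by
  fun_induction strings m n generalizing w with
  | case1 n =>
    rw [List.mem_singleton, List.eq_replicate_iff]
    constructor
    · rintro ⟨hlen, hw⟩
      refine ⟨List.countP_eq_zero.2 fun a ha => by simp [hw a ha, Letter.inLeft], ?_⟩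
      rw [← hlen, List.countP_eq_length]
      exact fun a ha => by simp [hw a ha, Letter.inRight]
    · rintro ⟨h0, hn⟩
      have hw : ∀ a ∈ w, a = Letter.R := fun a ha => by
        have := List.countP_eq_zero.1 h0 a ha
        cases a <;> simp_all [Letter.inLeft]
      refine ⟨?_, hw⟩
      rw [← hn, eq_comm, List.countP_eq_length]
      exact fun a ha => by simp [hw a ha, Letter.inRight]
  | case2 m =>
    rw [List.mem_singleton, List.eq_replicate_iff]
    constructor
    · rintro ⟨hlen, hw⟩
      refine ⟨?_, List.countP_eq_zero.2 fun a ha => by simp [hw a ha, Letter.inRight]⟩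
      rw [Nat.succ_eq_add_one, ← hlen, List.countP_eq_length]
      exact fun a ha => by simp [hw a ha, Letter.inLeft]
    · rintro ⟨hn, h0⟩
      have hw : ∀ a ∈ w, a = Letter.L := fun a ha => by
        have := List.countP_eq_zero.1 h0 a ha
        cases a <;> simp_all [Letter.inRight]
      refine ⟨?_, hw⟩
      rw [← Nat.succ_eq_add_one, ← hn, eq_comm, List.countP_eq_length]
      exact fun a ha => by simp [hw a ha, Letter.inLeft]
  | case3 m n ih1 ih2 ih3 =>
    simp only [List.mem_append, List.mem_map]
    cases w with
    | nil => simp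
    | cons a w =>
      cases a <;> simp [ih1, ih2, ih3, List.countP_cons, Letter.inLeft, Letter.inRight]

theorem pairwise_strings (m n : ℕ) : (strings m n).Pairwise (· < ·) := by
  have key : ∀ (a : Letter) (l : List (List Letter)), l.Pairwise (· < ·) →
      (l.map (a :: ·)).Pairwise (· < ·) := fun a l h =>
    List.pairwise_map.2 (h.imp fun h => List.cons_lt_cons_iff.2 (.inr ⟨rfl, h⟩))
  have hlt : ∀ {a b : Letter}, a.rank < b.rank → ∀ v w : List Letter, a :: v < b :: w :=
    fun h v w => List.cons_lt_cons_iff.2 (.inl h)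
  fun_induction strings m n with
  | case1 | case2 => exact List.pairwise_singleton _ _
  | case3 m n ih1 ih2 ih3 =>
    refine List.pairwise_append.2 ⟨key _ _ ih1, List.pairwise_append.2 ⟨key _ _ ih2, key _ _ ih3,
      ?_⟩, ?_⟩
    · simp only [List.mem_map]
      rintro _ ⟨v, _, rfl⟩ _ ⟨w, _, rfl⟩
      exact hlt (by decide) v w
    · simp only [List.mem_append, List.mem_map]
      rintro _ ⟨v, _, rfl⟩ _ (⟨w, _, rfl⟩ | ⟨w, _, rfl⟩) <;> exact hlt (by decide) v w

theorem length_strings_pos (m n : ℕ) : 0 < (strings m n).length := by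
  fun_induction strings m n <;> simp; omega

theorem length_strings_le (m n : ℕ) : (strings m n).length ≤ 3 ^ (m + n) := by
  fun_induction strings m n with
  | case1 n => simpa using Nat.one_le_pow _ _ (by norm_num)
  | case2 m => simpa using Nat.one_le_pow _ _ (by norm_num)
  | case3 m n ih1 ih2 ih3 =>
    have h1 : 3 ^ (m + 1 + (n + 1)) = 9 * 3 ^ (m + n) := by ring
    have h2 : 3 ^ (m + (n + 1)) = 3 * 3 ^ (m + n) := by ring
    have h3 : 3 ^ (m + 1 + n) = 3 * 3 ^ (m + n) := by ring
    simp only [List.length_append, List.length_map, Nat.succ_eq_add_one]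
    omega

end Patterns

/-! ### Orbits of products -/

section Products

variable {A B : Type*} [MulAction MonoAut A] [MulAction MonoAut B] {X : Set A} {Y : Set B}

theorem pattern_eq (x : A) (y : B) :
    pattern x y = supportPattern (leastSupport x) (leastSupport y) := rfl

theorem pattern_smul (g : MonoAut) (x : A) (y : B) : pattern (g • x) (g • y) = pattern x y := by
  rw [pattern_eq, leastSupport_smul, leastSupport_smul, supportPattern_map, pattern_eq]

theorem prodOrbitOf_smul (g : MonoAut) (z : A × B) : prodOrbitOf (g • z) = prodOrbitOf z := by
  simp only [prodOrbitOf, Prod.smul_fst, Prod.smul_snd, orbitOf_smul, pattern_smul]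

theorem pattern_mem_strings (x : A) (y : B) : pattern x y ∈ strings (dim x) (dim y) :=
  mem_strings.2 ⟨countP_inLeft_supportPattern, countP_inRight_supportPattern⟩

/-- A monotone bijection maps a finite set onto itself only by fixing its members. -/
theorem apply_eq_of_map_eq {S : Finset ℚ} {g : MonoAut} (h : S.map g.toEquiv.toEmbedding = S) :
    ∀ q ∈ S, g q = q := by
  have h1 : (S.sort (· ≤ ·)).map g = S.sort (· ≤ ·) := by
    refine (StrictMonoOn.map_finsetSort g.toEquiv.toEmbedding S (g.strictMono.strictMonoOn _)).trans ?_
    rw [h]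
  have h2 : (S.sort (· ≤ ·)).map g = (S.sort (· ≤ ·)).map id := by rw [h1, List.map_id]
  rw [List.map_inj_left] at h2
  exact fun q hq => h2 q ((Finset.mem_sort _).2 hq)

/-- Within an orbit, a finitely supported element is determined by its least support. -/
theorem eq_of_leastSupport_eq {x x' : A} (hx : ∃ S : Finset ℚ, IsSupport S x)
    (ho : orbitOf x' = orbitOf x) (hs : leastSupport x' = leastSupport x) : x' = x := by
  obtain ⟨g, rfl⟩ := orbitOf_eq_iff.1 ho
  rw [leastSupport_smul] at hs
  exact (isLeastSupport_leastSupport hx).1 g (apply_eq_of_map_eq hs)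

/-- The triple of projections and pattern determines the orbit of a pair. After moving the union of
the supports of one pair onto that of the other, the equal patterns say that the supports agree. -/
theorem orbitOf_eq_of_prodOrbitOf_eq {x x' : A} {y y' : B} (hx : ∃ S : Finset ℚ, IsSupport S x)
    (hy : ∃ S : Finset ℚ, IsSupport S y)
    (h : prodOrbitOf (x', y') = prodOrbitOf (x, y)) : orbitOf (x', y') = orbitOf (x, y) := by
  obtain ⟨hx', hy', hp⟩ : orbitOf x' = orbitOf x ∧ orbitOf y' = orbitOf y ∧
      pattern x' y' = pattern x y := by
    simpa [prodOrbitOf] using h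
  have hlen : ((leastSupport x' ∪ leastSupport y').sort (· ≤ ·)).length =
      ((leastSupport x ∪ leastSupport y).sort (· ≤ ·)).length := by
    rw [Finset.length_sort, Finset.length_sort, ← length_supportPattern, ← length_supportPattern]
    exact congrArg List.length hp
  obtain ⟨g, hg⟩ := exists_monoAut_map_eq (Finset.sortedLT_sort _).pairwise
    (Finset.sortedLT_sort _).pairwise hlen
  have hU : leastSupport (g • x') ∪ leastSupport (g • y') = leastSupport x ∪ leastSupport y := by
    rw [leastSupport_smul, leastSupport_smul, ← Finset.map_union]
    ext q
    rw [← Finset.mem_sort (· ≤ ·) (s := leastSupport x ∪ leastSupport y), ← hg, List.mem_map,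
      Finset.mem_map]
    simp only [Finset.mem_sort]
    rfl
  obtain ⟨h1, h2⟩ := eq_of_supportPattern_eq ((pattern_smul g x' y').trans hp) hU
  refine orbitOf_eq_iff.2 ⟨g⁻¹, ?_⟩
  rw [inv_smul_eq_iff, Prod.smul_mk,
    eq_of_leastSupport_eq hx ((orbitOf_smul g x').trans hx') h1,
    eq_of_leastSupport_eq hy ((orbitOf_smul g y').trans hy') h2]

/-- The triple of two orbits and a string. -/
def prodKey (o : Orb A) (o' : Orb B) (w : List Letter) : ProdOrb A B := toLex (o, toLex (o', w))

/-- The representations of the orbits of the product of two orbits, in increasing order. -/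
noncomputable def prodKeys (o : Orb A) (o' : Orb B) : List (ProdOrb A B) :=
  (strings (dim (Quotient.out o)) (dim (Quotient.out o'))).map (prodKey o o')

theorem length_prodKeys (o : Orb A) (o' : Orb B) : (prodKeys o o').length =
    (strings (dim (Quotient.out o)) (dim (Quotient.out o'))).length := by
  simp [prodKeys]

theorem length_prodKeys_pos (o : Orb A) (o' : Orb B) : 0 < (prodKeys o o').length := by
  rw [length_prodKeys]; exact length_strings_pos _ _

theorem pairwise_flatMap_prodKeys [LinearOrder (Orb A)] [LinearOrder (Orb B)] {l : List (Orb A)}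
    {l' : List (Orb B)} (hl : l.Pairwise (· < ·)) (hl' : l'.Pairwise (· < ·)) :
    (l.flatMap fun o => l'.flatMap (prodKeys o)).Pairwise (· < ·) := by
  simp only [List.pairwise_flatMap, List.mem_flatMap, prodKeys, List.pairwise_map, List.mem_map]
  refine ⟨fun o _ => ⟨fun o' _ => ?_, ?_⟩, ?_⟩
  · exact (pairwise_strings _ _).imp fun h => by simp [prodKey, Prod.Lex.toLex_lt_toLex, h]
  · refine hl'.imp fun h => ?_
    rintro _ ⟨v, _, rfl⟩ _ ⟨w, _, rfl⟩
    simp [prodKey, Prod.Lex.toLex_lt_toLex, h]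
  · refine hl.imp fun h => ?_
    rintro _ ⟨_, _, v, _, rfl⟩ _ ⟨_, _, w, _, rfl⟩
    simp [prodKey, Prod.Lex.toLex_lt_toLex, h]

/-- The representation of an orbit of `X ×ˢ Y` runs through all triples whose string fits the
dimensions of the two projections. -/
theorem mem_image_prodOrbitOf (hX : IsOrbitFiniteNominal X) (hY : IsOrbitFiniteNominal Y)
    {o : Orb A} {o' : Orb B} {w : List Letter} :
    (∃ z ∈ X ×ˢ Y, prodOrbitOf z = prodKey o o' w) ↔
      o ∈ orbitOf '' X ∧ o' ∈ orbitOf '' Y ∧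
        w ∈ strings (dim (Quotient.out o)) (dim (Quotient.out o')) := by
  constructor
  · rintro ⟨⟨x, y⟩, ⟨hx, hy⟩, h⟩
    obtain ⟨rfl, rfl, rfl⟩ : orbitOf x = o ∧ orbitOf y = o' ∧ pattern x y = w := by
      simpa [prodOrbitOf, prodKey] using h
    refine ⟨⟨x, hx, rfl⟩, ⟨y, hy, rfl⟩, ?_⟩
    rw [dim_eq_of_orbitOf_eq (orbitOf_out (orbitOf x)),
      dim_eq_of_orbitOf_eq (orbitOf_out (orbitOf y))]
    exact pattern_mem_strings x y
  · rintro ⟨⟨x, hx, rfl⟩, ⟨y, hy, rfl⟩, hw⟩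
    rw [dim_eq_of_orbitOf_eq (orbitOf_out (orbitOf x)),
      dim_eq_of_orbitOf_eq (orbitOf_out (orbitOf y))] at hw
    obtain ⟨S, T, rfl⟩ := exists_supportPattern_eq w
    rw [mem_strings, countP_inLeft_supportPattern, countP_inRight_supportPattern] at hw
    -- each component is moved separately, so as to have the support that the string asks for
    have move : ∀ V W : Finset ℚ, V.card = W.card →
        ∃ g : MonoAut, W.map g.toEquiv.toEmbedding = V := by
      intro V W h
      obtain ⟨g, hg⟩ := exists_monoAut_map_eq (Finset.sortedLT_sort W).pairwise
        (Finset.sortedLT_sort V).pairwise (by simp [h])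
      refine ⟨g, ?_⟩
      ext q
      rw [← Finset.mem_sort (· ≤ ·) (s := V), ← hg, List.mem_map, Finset.mem_map]
      simp only [Finset.mem_sort]
      rfl
    obtain ⟨g, hg⟩ := move S (leastSupport x) hw.1
    obtain ⟨h, hh⟩ := move T (leastSupport y) hw.2
    refine ⟨(g • x, h • y), ⟨hX.equivariant g x hx, hY.equivariant h y hy⟩, ?_⟩
    simp only [prodOrbitOf, prodKey, orbitOf_smul, pattern_eq, leastSupport_smul, hg, hh]

theorem mem_flatMap_prodKeys (hX : IsOrbitFiniteNominal X) (hY : IsOrbitFiniteNominal Y)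
    {l : List (Orb A)} {l' : List (Orb B)} (hl : ∀ o, o ∈ l ↔ o ∈ orbitOf '' X)
    (hl' : ∀ o, o ∈ l' ↔ o ∈ orbitOf '' Y) (k : ProdOrb A B) :
    k ∈ (l.flatMap fun o => l'.flatMap (prodKeys o)) ↔ ∃ z ∈ X ×ˢ Y, prodOrbitOf z = k := by
  obtain ⟨o, o', w, rfl⟩ : ∃ o o' w, k = prodKey o o' w := ⟨_, _, _, rfl⟩
  rw [mem_image_prodOrbitOf hX hY, ← hl, ← hl']
  simp only [List.mem_flatMap, prodKeys, List.mem_map, prodKey, EmbeddingLike.apply_eq_iff_eq,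
    Prod.mk.injEq]
  constructor
  · rintro ⟨_, ho, _, ho', _, hw, rfl, rfl, rfl⟩
    exact ⟨ho, ho', hw⟩
  · rintro ⟨ho, ho', hw⟩
    exact ⟨o, ho, o', ho', w, hw, rfl, rfl, rfl⟩

theorem prodOrbitOf_out (z : A × B) : prodOrbitOf (Quotient.out (orbitOf z)) = prodOrbitOf z := by
  obtain ⟨g, hg⟩ := orbitOf_eq_iff.1 (orbitOf_out (orbitOf z))
  rw [← hg, prodOrbitOf_smul]

theorem injOn_prodOrbitOf_out (hX : IsOrbitFiniteNominal X) (hY : IsOrbitFiniteNominal Y) :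
    Set.InjOn (fun o : Orb (A × B) => prodOrbitOf (Quotient.out o)) (orbitOf '' (X ×ˢ Y)) := by
  rintro _ ⟨⟨x', y'⟩, _, rfl⟩ _ ⟨⟨x, y⟩, ⟨hx, hy⟩, rfl⟩ h
  simp only [prodOrbitOf_out] at h
  exact orbitOf_eq_of_prodOrbitOf_eq (hX.supported x hx) (hY.supported y hy) h

/-- The number of orbits of a product is the number of their representations. -/
theorem numOrbits_prod (hX : IsOrbitFiniteNominal X) (hY : IsOrbitFiniteNominal Y) :
    numOrbits (X ×ˢ Y) = (prodOrbitOf '' (X ×ˢ Y)).ncard := by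
  rw [numOrbits, ← (injOn_prodOrbitOf_out hX hY).ncard_image, Set.image_image]
  simp only [prodOrbitOf_out]

theorem IsOrbitFiniteNominal.prod (hX : IsOrbitFiniteNominal X) (hY : IsOrbitFiniteNominal Y) :
    IsOrbitFiniteNominal (X ×ˢ Y) where
  equivariant g z hz := ⟨hX.equivariant g _ hz.1, hY.equivariant g _ hz.2⟩
  supported z hz := by
    obtain ⟨S, hS⟩ := hX.supported _ hz.1
    obtain ⟨T, hT⟩ := hY.supported _ hz.2
    exact ⟨S ∪ T, fun g hg => Prod.ext (hS.mono Finset.subset_union_left g hg)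
      (hT.mono Finset.subset_union_right g hg)⟩
  orbitFinite := by
    -- finitely many orbits have one of the finitely many representations
    let l := hX.orbitFinite.toFinset.toList
    let l' := hY.orbitFinite.toFinset.toList
    have hkeys : (prodOrbitOf '' (X ×ˢ Y)).Finite := by
      refine (l.flatMap fun o => l'.flatMap (prodKeys o)).finite_toSet.subset ?_
      exact fun k hk => (mem_flatMap_prodKeys hX hY (by simp [l]) (by simp [l']) k).2 hk
    refine Set.Finite.of_finite_image (f := fun o => prodOrbitOf (Quotient.out o)) ?_ ?_
    · simpa only [Set.image_image, prodOrbitOf_out] using hkeys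
    · exact injOn_prodOrbitOf_out hX hY

theorem numOrbits_prod_le (hX : IsOrbitFiniteNominal X) (hY : IsOrbitFiniteNominal Y) :
    numOrbits (X ×ˢ Y) ≤ 3 ^ (setDim X + setDim Y) * (numOrbits X * numOrbits Y) := by
  classical
  let l := hX.orbitFinite.toFinset.toList
  let l' := hY.orbitFinite.toFinset.toList
  have hl : ∀ o, o ∈ l ↔ o ∈ orbitOf '' X := by simp [l]
  have hl' : ∀ o, o ∈ l' ↔ o ∈ orbitOf '' Y := by simp [l']
  have hlen : l.length = numOrbits X := by
    rw [numOrbits, Set.ncard_eq_toFinset_card _ hX.orbitFinite, Finset.length_toList]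
  have hlen' : l'.length = numOrbits Y := by
    rw [numOrbits, Set.ncard_eq_toFinset_card _ hY.orbitFinite, Finset.length_toList]
  have hone : ∀ o ∈ l, ∀ o' ∈ l', (prodKeys o o').length ≤ 3 ^ (setDim X + setDim Y) := by
    intro o ho o' ho'
    have h1 : Quotient.out o ∈ X :=
      hX.orbitOf_mem_image.1 (by rw [orbitOf_out]; exact (hl o).1 ho)
    have h2 : Quotient.out o' ∈ Y :=
      hY.orbitOf_mem_image.1 (by rw [orbitOf_out]; exact (hl' o').1 ho')
    rw [length_prodKeys]
    exact (length_strings_le _ _).trans (Nat.pow_le_pow_right (by norm_num)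
      (Nat.add_le_add (hX.dim_le_setDim h1) (hY.dim_le_setDim h2)))
  have hrow : ∀ o ∈ l, (l'.flatMap (prodKeys o)).length ≤
      l'.length * 3 ^ (setDim X + setDim Y) := by
    intro o ho
    rw [List.length_flatMap, ← smul_eq_mul]
    refine (List.sum_le_card_nsmul _ _ ?_).trans_eq (by rw [List.length_map])
    simp only [List.mem_map]
    rintro _ ⟨o', ho', rfl⟩
    exact hone o ho o' ho'
  have hall : (l.flatMap fun o => l'.flatMap (prodKeys o)).length ≤
      l.length * (l'.length * 3 ^ (setDim X + setDim Y)) := by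
    rw [List.length_flatMap, ← smul_eq_mul]
    refine (List.sum_le_card_nsmul _ _ ?_).trans_eq (by rw [List.length_map])
    simp only [List.mem_map]
    rintro _ ⟨o, ho, rfl⟩
    exact hrow o ho
  have hsub : prodOrbitOf '' (X ×ˢ Y) ⊆
      ((l.flatMap fun o => l'.flatMap (prodKeys o)).toFinset : Set (ProdOrb A B)) := fun k hk => by
    rw [Finset.mem_coe, List.mem_toFinset]
    exact (mem_flatMap_prodKeys hX hY hl hl' k).2 hk
  calc numOrbits (X ×ˢ Y) = (prodOrbitOf '' (X ×ˢ Y)).ncard := numOrbits_prod hX hY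
    _ ≤ _ := Set.ncard_le_ncard hsub (Finset.finite_toSet _)
    _ ≤ _ := by rw [Set.ncard_coe_finset]; exact List.toFinset_card_le _
    _ ≤ _ := hall
    _ = _ := by rw [hlen, hlen']; ring

end Products

/-! ### Reasoning about evaluation -/

namespace Expr

/-- Apply a primitive operation and put its result in front of the values in scope. -/
abbrev opThen (p : Prim) (is : List ℕ) (e : Expr) : Expr := .letE (.op p is) e

/-- Call a function and put its result in front of the values in scope. -/
abbrev callThen (f : ℕ) (is : List ℕ) (e : Expr) : Expr := .letE (.call f is) e

end Expr

/-- The values at the given positions of a list. -/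
def readAll {V : Type*} (env : List V) : List ℕ → Option (List V)
  | [] => some []
  | i :: is => (env[i]?).bind fun v => (readAll env is).map (v :: ·)

theorem forall₂_of_readAll {V : Type*} {env : List V} {is : List ℕ} {vs : List V}
    (h : readAll env is = some vs) : List.Forall₂ (fun (i : ℕ) w => env[i]? = some w) is vs := by
  induction is generalizing vs with
  | nil => cases h; exact .nil
  | cons i is ih =>
    simp only [readAll, Option.bind_eq_some_iff, Option.map_eq_some_iff] at h
    obtain ⟨v, hv, ws, hws, rfl⟩ := h
    exact .cons hv (ih hws)

section Evaluation

variable {A B : Type*} [MulAction MonoAut A] [MulAction MonoAut B]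
  [LinearOrder (Orb A)] [LinearOrder (Orb B)]

/-- The evaluation of `e` ends with the value `v` after at most `N` steps. -/
def EvalsWithin (U : UserFns A B) (F : List Expr) (env : List (Val A B)) (e : Expr) (v : Val A B)
    (N : ℕ) : Prop :=
  ∃ n, Eval U F env e v n ∧ n ≤ N

namespace EvalsWithin

variable {U : UserFns A B} {F : List Expr} {env : List (Val A B)} {e e' : Expr} {v w : Val A B}
  {vs : List (Val A B)} {p : Prim} {is : List ℕ} {f i M N : ℕ} {b : Bool}

theorem mono (h : EvalsWithin U F env e v M) (hMN : M ≤ N) : EvalsWithin U F env e v N :=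
  h.imp fun _ h => ⟨h.1, h.2.trans hMN⟩

theorem var (h : env[i]? = some v) : EvalsWithin U F env (.var i) v 1 :=
  ⟨1, .var h, le_rfl⟩

theorem op (h : (readAll env is).bind (primResult U p) = some v) :
    EvalsWithin U F env (.op p is) v 1 := by
  obtain ⟨vs, hvs, hv⟩ := Option.bind_eq_some_iff.1 h
  exact ⟨1, .op (forall₂_of_readAll hvs) hv, le_rfl⟩

theorem letE (h : EvalsWithin U F env e v M) (h' : EvalsWithin U F (v :: env) e' w N) :
    EvalsWithin U F env (.letE e e') w (M + N + 1) := by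
  obtain ⟨m, hm, hmM⟩ := h
  obtain ⟨n, hn, hnN⟩ := h'
  exact ⟨_, .letE hm hn, by omega⟩

theorem call (hf : F[f]? = some e) (hvs : readAll env is = some vs)
    (h : EvalsWithin U F vs e v N) : EvalsWithin U F env (.call f is) v (N + 1) := by
  obtain ⟨n, hn, hnN⟩ := h
  exact ⟨_, .call (forall₂_of_readAll hvs) hf hn, by omega⟩

theorem opThen (h : (readAll env is).bind (primResult U p) = some v)
    (h' : EvalsWithin U F (v :: env) e w N) : EvalsWithin U F env (.opThen p is e) w (N + 2) :=
  (letE (op h) h').mono (by omega)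

theorem callThen (hf : F[f]? = some e) (hvs : readAll env is = some vs)
    (h : EvalsWithin U F vs e v M) (h' : EvalsWithin U F (v :: env) e' w N) :
    EvalsWithin U F env (.callThen f is e') w (M + N + 2) :=
  (letE (call hf hvs h) h').mono (by omega)

theorem iteTrue (hi : env[i]? = some (.bool b)) (hb : b = true)
    (h : EvalsWithin U F env e v N) : EvalsWithin U F env (.ite i e e') v (N + 1) := by
  obtain ⟨n, hn, hnN⟩ := h
  exact ⟨_, .iteTrue (hb ▸ hi) hn, by omega⟩

theorem iteFalse (hi : env[i]? = some (.bool b)) (hb : b = false)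
    (h : EvalsWithin U F env e' v N) : EvalsWithin U F env (.ite i e e') v (N + 1) := by
  obtain ⟨n, hn, hnN⟩ := h
  exact ⟨_, .iteFalse (hb ▸ hi) hn, by omega⟩

end EvalsWithin

end Evaluation

/-! ### The programs

A comment on the right of a binding lists the values in scope after it. -/

/-! The positions of the functions in the table `funTable`. -/

namespace Fn

abbrev flatten : ℕ := 0
abbrev union : ℕ := 1
abbrev inter : ℕ := 2
abbrev subset : ℕ := 3
abbrev length : ℕ := 4
abbrev build : ℕ := 5
abbrev mkSet : ℕ := 6
abbrev member : ℕ := 7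
abbrev allMember : ℕ := 8
abbrev mulLog : ℕ := 9
abbrev filter : ℕ := 10
abbrev image : ℕ := 11
abbrev strings : ℕ := 12
abbrev prodOne : ℕ := 13
abbrev prod : ℕ := 14

end Fn

namespace Body

open Expr

/-- `(t, acc)`: the keys of the tree `t` from left to right, followed by the list `acc`. -/
def flatten : Expr :=
  opThen .isNil [0] <|               -- b t acc
  .ite 0 (.var 2) <|
  opThen .snd [1] <|                 -- lr b t acc
  opThen .snd [0] <|                 -- r lr b t acc
  callThen Fn.flatten [0, 4] <|      -- acc' r lr b t acc
  opThen .fst [4] <|                 -- k acc' r lr b t acc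
  opThen .pair [0, 1] <|             -- acc'' k acc' r lr b t acc
  opThen .fst [4] <|                 -- l acc'' k acc' r lr b t acc
  .call Fn.flatten [0, 1]

/-- `(a, b)`: merge the increasing lists `a` and `b`, without repetitions. -/
def union : Expr :=
  opThen .isNil [0] <|               -- n a b
  .ite 0 (.var 2) <|
  opThen .isNil [2] <|               -- n' n a b
  .ite 0 (.var 2) <|
  opThen .fst [2] <|                 -- x n' n a b
  opThen .fst [4] <|                 -- y x n' n a b
  opThen .orbLt [1, 0] <|            -- c y x n' n a b
  .ite 0
    (opThen .snd [5] <|              -- a' c y x n' n a b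
     callThen Fn.union [0, 7] <|     -- u a' c y x n' n a b
     .op .pair [4, 0])
    (opThen .orbLt [1, 2] <|         -- c' c y x n' n a b
     .ite 0
      (opThen .snd [7] <|            -- b' c' c y x n' n a b
       callThen Fn.union [7, 0] <|   -- u b' c' c y x n' n a b
       .op .pair [4, 0])
      (opThen .snd [6] <|            -- a' c' c y x n' n a b
       opThen .snd [8] <|            -- b' a' c' c y x n' n a b
       callThen Fn.union [1, 0] <|   -- u b' a' c' c y x n' n a b
       .op .pair [6, 0]))

/-- `(a, b)`: the common members of the increasing lists `a` and `b`. -/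
def inter : Expr :=
  opThen .isNil [0] <|               -- n a b
  .ite 0 (.op .nil []) <|
  opThen .isNil [2] <|               -- n' n a b
  .ite 0 (.op .nil []) <|
  opThen .fst [2] <|                 -- x n' n a b
  opThen .fst [4] <|                 -- y x n' n a b
  opThen .orbLt [1, 0] <|            -- c y x n' n a b
  .ite 0
    (opThen .snd [5] <|              -- a' c y x n' n a b
     .call Fn.inter [0, 7])
    (opThen .orbLt [1, 2] <|         -- c' c y x n' n a b
     .ite 0
      (opThen .snd [7] <|            -- b' c' c y x n' n a b
       .call Fn.inter [7, 0])
      (opThen .snd [6] <|            -- a' c' c y x n' n a b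
       opThen .snd [8] <|            -- b' a' c' c y x n' n a b
       callThen Fn.inter [1, 0] <|   -- u b' a' c' c y x n' n a b
       .op .pair [6, 0]))

/-- `(a, b)`: is each member of the increasing list `a` a member of the increasing list `b`? -/
def subset : Expr :=
  opThen .isNil [0] <|               -- n a b
  .ite 0 (.op (.lit true) []) <|
  opThen .isNil [2] <|               -- n' n a b
  .ite 0 (.op (.lit false) []) <|
  opThen .fst [2] <|                 -- x n' n a b
  opThen .fst [4] <|                 -- y x n' n a b
  opThen .orbLt [1, 0] <|            -- c y x n' n a b
  .ite 0 (.op (.lit false) [])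
    (opThen .orbLt [1, 2] <|         -- c' c y x n' n a b
     .ite 0
      (opThen .snd [7] <|            -- b' c' c y x n' n a b
       .call Fn.subset [7, 0])
      (opThen .snd [6] <|            -- a' c' c y x n' n a b
       opThen .snd [8] <|            -- b' a' c' c y x n' n a b
       .call Fn.subset [1, 0]))

/-- `(l)`: the length of the list `l`. -/
def length : Expr :=
  opThen .isNil [0] <|               -- n l
  .ite 0 (.op (.const 0) []) <|
  opThen .snd [1] <|                 -- l' n l
  callThen Fn.length [0] <|          -- m l' n l
  opThen (.const 1) [] <|            -- 1 m l' n l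
  .op .add [1, 0]

/-- `(n, l)`: a balanced tree on the first `n` members of `l`, paired with the remaining ones. -/
def build : Expr :=
  opThen (.const 0) [] <|            -- 0 n l
  opThen .le [1, 0] <|               -- c 0 n l
  .ite 0
    (opThen .nil [] <|               -- nil c 0 n l
     .op .pair [0, 4])
    (opThen .half [2] <|             -- h c 0 n l
     callThen Fn.build [0, 4] <|     -- p h c 0 n l
     opThen .snd [0] <|              -- l' p h c 0 n l
     opThen (.const 1) [] <|         -- 1 l' p h c 0 n l
     opThen .sub [6, 3] <|           -- n-h 1 l' p h c 0 n l
     opThen .sub [0, 1] <|           -- m n-h 1 l' p h c 0 n l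
     opThen .snd [3] <|              -- l'' m n-h 1 l' p h c 0 n l
     callThen Fn.build [1, 0] <|     -- q l'' m n-h 1 l' p h c 0 n l
     opThen .fst [5] <|              -- k q l'' m n-h 1 l' p h c 0 n l
     opThen .fst [7] <|              -- left k q l'' m n-h 1 l' p h c 0 n l
     opThen .fst [2] <|              -- right left k q ...
     opThen .pair [1, 0] <|          -- lr right left k q ...
     opThen .pair [3, 0] <|          -- t lr right left k q ...
     opThen .snd [5] <|              -- rest t lr right left k q ...
     .op .pair [1, 0])

/-- `(l)`: the representation of the set whose orbits are listed by `l` in increasing order. -/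
def mkSet : Expr :=
  callThen Fn.length [0] <|          -- n l
  callThen Fn.build [0, 1] <|        -- p n l
  opThen .fst [0] <|                 -- t p n l
  .op .pair [2, 0]

/-- `(o, t)`: is `o` a key of the search tree `t`? -/
def member : Expr :=
  opThen .isNil [1] <|               -- b o t
  .ite 0 (.op (.lit false) []) <|
  opThen .fst [2] <|                 -- k b o t
  opThen .snd [3] <|                 -- lr k b o t
  opThen .orbLt [3, 1] <|            -- c lr k b o t
  .ite 0
    (opThen .fst [1] <|              -- l c lr k b o t
     .call Fn.member [5, 0])
    (opThen .orbLt [2, 4] <|         -- c' c lr k b o t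
     .ite 0
      (opThen .snd [2] <|            -- r c' c lr k b o t
       .call Fn.member [6, 0])
      (.op (.lit true) []))

/-- `(t, s)`: is each key of the tree `t` a key of the search tree `s`? -/
def allMember : Expr :=
  opThen .isNil [0] <|               -- b t s
  .ite 0 (.op (.lit true) []) <|
  opThen .fst [1] <|                 -- k b t s
  callThen Fn.member [0, 3] <|       -- m k b t s
  .ite 0
    (opThen .snd [3] <|              -- lr m k b t s
     opThen .fst [0] <|              -- l lr m k b t s
     callThen Fn.allMember [0, 6] <| -- m' l lr m k b t s
     .ite 0
      (opThen .snd [2] <|            -- r m' l lr m k b t s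
       .call Fn.allMember [0, 8])
      (.op (.lit false) []))
    (.op (.lit false) [])

/-- `(m, n)`: the product of `m` and `⌊log₂ n⌋`. -/
def mulLog : Expr :=
  opThen (.const 1) [] <|            -- 1 m n
  opThen .le [2, 0] <|               -- c 1 m n
  .ite 0 (.op (.const 0) []) <|
  opThen .half [3] <|                -- h c 1 m n
  callThen Fn.mulLog [3, 0] <|       -- r h c 1 m n
  .op .add [4, 0]

/-- `(l)`: the members of `l` whose sample elements satisfy the user-defined predicate. -/
def filter : Expr :=
  opThen .isNil [0] <|               -- n l
  .ite 0 (.op .nil []) <|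
  opThen .fst [1] <|                 -- k n l
  opThen .getElement [0] <|          -- x k n l
  opThen .callPred [0] <|            -- p x k n l
  opThen .snd [4] <|                 -- l' p x k n l
  callThen Fn.filter [0] <|          -- r l' p x k n l
  .ite 2 (.op .pair [4, 0]) (.var 0)

/-- `(t)`: the increasing list of the orbits of the values of the user-defined function at the
sample elements of the keys of the tree `t`. This is a merge sort along `t`. -/
def image : Expr :=
  opThen .isNil [0] <|               -- b t
  .ite 0 (.op .nil []) <|
  opThen .fst [1] <|                 -- k b t
  opThen .snd [2] <|                 -- lr k b t
  opThen .fst [0] <|                 -- l lr k b t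
  callThen Fn.image [0] <|           -- u l lr k b t
  opThen .snd [2] <|                 -- r u l lr k b t
  callThen Fn.image [0] <|           -- v r u l lr k b t
  opThen .getElement [5] <|          -- x v r u l lr k b t
  opThen .callFn [0] <|              -- y x v r u l lr k b t
  opThen .orbitOf [0] <|             -- o y x v r u l lr k b t
  opThen .nil [] <|                  -- nil o y x v r u l lr k b t
  opThen .pair [1, 0] <|             -- [o] nil o y x v r u l lr k b t
  callThen Fn.union [7, 0] <|        -- u' [o] nil o y x v r u l lr k b t
  .call Fn.union [0, 6]

/-- `(o, o', w, d, d', acc)`: the triples of `o`, `o'` and a string that starts with `w` and goes on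
with a member of `strings d d'`, in increasing order, followed by the list `acc`. -/
def strings : Expr :=
  opThen (.const 0) [] <|            -- 0 o o' w d d' acc
  opThen .le [4, 0] <|               -- c 0 o o' w d d' acc
  .ite 0
    (opThen (.append .R) [4, 6] <|   -- w' c 0 o o' w d d' acc
     opThen .pair [4, 0] <|          -- q w' c 0 o o' w d d' acc
     opThen .pair [4, 0] <|          -- k q w' c 0 o o' w d d' acc
     .op .pair [0, 10])
    (opThen .le [6, 1] <|            -- c' c 0 o o' w d d' acc
     .ite 0
      (opThen (.append .L) [5, 6] <| -- w' c' c 0 o o' w d d' acc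
       opThen .pair [5, 0] <|        -- q w' c' c 0 o o' w d d' acc
       opThen .pair [5, 0] <|        -- k q w' c' c 0 o o' w d d' acc
       .op .pair [0, 11])
      (opThen (.const 1) [] <|       -- 1 c' c 0 o o' w d d' acc
       opThen .sub [7, 0] <|         -- d-1 1 c' c 0 o o' w d d' acc
       opThen .sub [9, 1] <|         -- d'-1 d-1 1 c' c 0 o o' w d d' acc
       opThen (.append .B) [8, 2] <| -- wB d'-1 d-1 1 c' c 0 o o' w d d' acc
       callThen Fn.strings [7, 8, 0, 2, 1, 12] <|
                                     -- aB wB d'-1 d-1 1 c' c 0 o o' w d d' acc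
       opThen (.append .R) [10, 4] <|
                                     -- wR aB wB d'-1 d-1 1 c' c 0 o o' w d d' acc
       callThen Fn.strings [9, 10, 0, 12, 3, 1] <|
                                     -- aR wR aB wB d'-1 d-1 1 c' c 0 o o' w d d' acc
       opThen (.append .L) [12, 6] <|
                                     -- wL aR wR aB wB d'-1 d-1 1 c' c 0 o o' w d d' acc
       .call Fn.strings [11, 12, 0, 6, 15, 1]))

/-- `(o, s, acc)`: the orbits of the product of the orbit `o` with the orbits in the tree `s`, in
increasing order, followed by the list `acc`. -/
def prodOne : Expr :=
  opThen .isNil [1] <|               -- b o s acc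
  .ite 0 (.var 3) <|
  opThen .fst [2] <|                 -- k b o s acc
  opThen .snd [3] <|                 -- lr k b o s acc
  opThen .snd [0] <|                 -- r lr k b o s acc
  callThen Fn.prodOne [4, 0, 6] <|   -- acc' r lr k b o s acc
  opThen .emptyWord [] <|            -- w acc' r lr k b o s acc
  opThen .supportSize [6] <|         -- d w acc' r lr k b o s acc
  opThen .supportSize [5] <|         -- d' d w acc' r lr k b o s acc
  callThen Fn.strings [8, 6, 2, 1, 0, 3] <|
                                     -- acc'' d' d w acc' r lr k b o s acc
  opThen .fst [6] <|                 -- l acc'' d' d w acc' r lr k b o s acc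
  .call Fn.prodOne [10, 0, 1]

/-- `(t, s, acc)`: the orbits of the products of the orbits in the tree `t` with those in the tree
`s`, in increasing order, followed by the list `acc`. -/
def prod : Expr :=
  opThen .isNil [0] <|               -- b t s acc
  .ite 0 (.var 3) <|
  opThen .snd [1] <|                 -- lr b t s acc
  opThen .snd [0] <|                 -- r lr b t s acc
  callThen Fn.prod [0, 4, 5] <|      -- acc' r lr b t s acc
  opThen .fst [4] <|                 -- k acc' r lr b t s acc
  callThen Fn.prodOne [0, 6, 1] <|   -- acc'' k acc' r lr b t s acc
  opThen .fst [4] <|                 -- l acc'' k acc' r lr b t s acc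
  .call Fn.prod [0, 8, 1]

end Body

/-- The functions that all programs share, in the order of their numbers in `Fn`. -/
def funTable : List Expr :=
  [Body.flatten, Body.union, Body.inter, Body.subset, Body.length, Body.build, Body.mkSet,
    Body.member, Body.allMember, Body.mulLog, Body.filter, Body.image, Body.strings, Body.prodOne,
    Body.prod]

namespace Main

open Expr

/-- `(x, X)`: is `x` a member of `X`? -/
def test : Expr :=
  opThen .orbitOf [0] <|             -- o x X
  opThen .snd [2] <|                 -- t o x X
  .call Fn.member [1, 0]

/-- `(X, Y)`: is `X` a subset of `Y`? Having discarded the case of more orbits in `X` than in `Y`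
and that of an empty `X`, choose the cheaper of a merge and of a search for each orbit of `X`. -/
def incl : Expr :=
  opThen .fst [0] <|                 -- m X Y
  opThen .fst [2] <|                 -- n m X Y
  opThen .snd [2] <|                 -- t n m X Y
  opThen .snd [4] <|                 -- s t n m X Y
  opThen .le [3, 2] <|               -- c s t n m X Y
  .ite 0
    (opThen (.const 0) [] <|         -- 0 c s t n m X Y
     opThen .le [5, 0] <|            -- c' 0 c s t n m X Y
     .ite 0 (.op (.lit true) [])
      (callThen Fn.mulLog [6, 5] <|  -- p c' 0 c s t n m X Y
       opThen .add [7, 6] <|         -- q p c' 0 c s t n m X Y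
       opThen .le [0, 1] <|          -- c'' q p c' 0 c s t n m X Y
       .ite 0
        (opThen .nil [] <|           -- nil c'' q p c' 0 c s t n m X Y
         callThen Fn.flatten [8, 0] <|
                                     -- a nil c'' q p c' 0 c s t n m X Y
         callThen Fn.flatten [8, 1] <|
                                     -- b a nil c'' q p c' 0 c s t n m X Y
         .call Fn.subset [1, 0])
        (.call Fn.allMember [7, 6])))
    (.op (.lit false) [])

/-- `(X, Y)`: the union of `X` and `Y`. -/
def union : Expr :=
  opThen .snd [0] <|                 -- t X Y
  opThen .snd [2] <|                 -- s t X Y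
  opThen .nil [] <|                  -- nil s t X Y
  callThen Fn.flatten [2, 0] <|      -- a nil s t X Y
  callThen Fn.flatten [2, 1] <|      -- b a nil s t X Y
  callThen Fn.union [1, 0] <|        -- c b a nil s t X Y
  .call Fn.mkSet [0]

/-- `(X, Y)`: the intersection of `X` and `Y`. -/
def inter : Expr :=
  opThen .snd [0] <|                 -- t X Y
  opThen .snd [2] <|                 -- s t X Y
  opThen .nil [] <|                  -- nil s t X Y
  callThen Fn.flatten [2, 0] <|      -- a nil s t X Y
  callThen Fn.flatten [2, 1] <|      -- b a nil s t X Y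
  callThen Fn.inter [1, 0] <|        -- c b a nil s t X Y
  .call Fn.mkSet [0]

/-- `(X)`: the members of `X` that satisfy the user-defined predicate. -/
def filter : Expr :=
  opThen .snd [0] <|                 -- t X
  opThen .nil [] <|                  -- nil t X
  callThen Fn.flatten [1, 0] <|      -- a nil t X
  callThen Fn.filter [0] <|          -- c a nil t X
  .call Fn.mkSet [0]

/-- `(X)`: the image of `X` under the user-defined function. -/
def image : Expr :=
  opThen .snd [0] <|                 -- t X
  callThen Fn.image [0] <|           -- c t X
  .call Fn.mkSet [0]

/-- `(X, Y)`: the product of `X` and `Y`. An empty `Y` is treated apart, because there is no time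
to go through `X` then. -/
def prod : Expr :=
  opThen .fst [1] <|                 -- n X Y
  opThen (.const 0) [] <|            -- 0 n X Y
  opThen .le [1, 0] <|               -- c 0 n X Y
  .ite 0
    (opThen .nil [] <|               -- nil c 0 n X Y
     .op .pair [2, 0])
    (opThen .snd [3] <|              -- t c 0 n X Y
     opThen .snd [5] <|              -- s t c 0 n X Y
     opThen .nil [] <|               -- nil s t c 0 n X Y
     callThen Fn.prod [2, 1, 0] <|   -- a nil s t c 0 n X Y
     .call Fn.mkSet [0])

end Main

/-! ### Evaluation of the shared functions -/

section Lists

variable {A B : Type*} [MulAction MonoAut A] [MulAction MonoAut B]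

/-- A list as a value, when `e` turns its members into values. -/
def listVal {K : Type*} (e : K → Val A B) : List K → Val A B
  | [] => .nil
  | k :: l => .pair (e k) (listVal e l)

end Lists

theorem length_inorder {K : Type*} (t : BinaryTree K) : (inorder t).length = t.numNodes := by
  induction t with
  | nil => rfl
  | node k l r ihl ihr => simp [inorder, ihl, ihr]; omega

section Functions

variable {A B : Type*} [MulAction MonoAut A] [MulAction MonoAut B]
  [LinearOrder (Orb A)] [LinearOrder (Orb B)] {U : UserFns A B} {K : Type*} {e : K → Val A B}

theorem evalsWithin_flatten (t : BinaryTree K) (acc : List K) :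
    EvalsWithin U funTable [treeVal e t, listVal e acc] Body.flatten
      (listVal e (inorder t ++ acc)) (20 * (2 * t.numNodes + 1)) := by
  induction t generalizing acc with
  | nil => exact .mono (.opThen rfl (.iteTrue rfl rfl (.var rfl))) (by simp)
  | node k l r ihl ihr =>
    rw [inorder, List.append_assoc]
    exact .mono (.opThen rfl (.iteFalse rfl rfl (.opThen rfl (.opThen rfl
      (.callThen rfl rfl (ihr acc) (.opThen rfl (.opThen rfl (.opThen rfl
      (.call rfl rfl (ihl (k :: (inorder r ++ acc))))))))))))
      (by simp only [BinaryTree.numNodes]; omega)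

theorem evalsWithin_length (l : List K) :
    EvalsWithin U funTable [listVal e l] Body.length (.num l.length) (20 * (l.length + 1)) := by
  induction l with
  | nil => exact .mono (.opThen rfl (.iteTrue rfl rfl (.op rfl))) (by simp)
  | cons k l ih =>
    exact .mono (.opThen rfl (.iteFalse rfl rfl (.opThen rfl (.callThen rfl rfl ih
      (.opThen rfl (.op rfl)))))) (by simp only [List.length_cons]; omega)

open Classical in
/-- The program can compare the keys that `e` turns into values. -/
def Comparable [LinearOrder K] (U : UserFns A B) (e : K → Val A B) : Prop :=
  ∀ k k', primResult U .orbLt [e k, e k'] = some (.bool (decide (k < k')))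

theorem comparable_orbA : Comparable U (Val.orbA : Orb A → Val A B) := fun _ _ => rfl

theorem comparable_orbB : Comparable U (Val.orbB : Orb B → Val A B) := fun _ _ => rfl

section Sorted

variable [LinearOrder K] (he : Comparable U e)
include he

theorem evalsWithin_union {a b : List K} (ha : a.Pairwise (· < ·)) (hb : b.Pairwise (· < ·)) :
    ∃ c : List K, c.Pairwise (· < ·) ∧ (∀ k, k ∈ c ↔ k ∈ a ∨ k ∈ b) ∧
      c.length ≤ a.length + b.length ∧
      EvalsWithin U funTable [listVal e a, listVal e b] Body.union (listVal e c)
        (40 * (a.length + b.length + 1)) := by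
  induction a generalizing b with
  | nil =>
    exact ⟨b, hb, by simp, by simp,
      .mono (.opThen rfl (.iteTrue rfl rfl (.var rfl))) (by simp; omega)⟩
  | cons x a iha =>
    induction b with
    | nil =>
      exact ⟨x :: a, ha, by simp, by simp, .mono (.opThen rfl (.iteFalse rfl rfl
        (.opThen rfl (.iteTrue rfl rfl (.var rfl))))) (by simp; omega)⟩
    | cons y b ihb =>
      obtain ⟨hxa, ha'⟩ := List.pairwise_cons.1 ha
      obtain ⟨hyb, hb'⟩ := List.pairwise_cons.1 hb
      rcases lt_trichotomy x y with hxy | rfl | hxy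
      · obtain ⟨c, hc, hmem, hlen, hev⟩ := iha ha' hb
        refine ⟨x :: c, List.pairwise_cons.2 ⟨fun k hk => ?_, hc⟩, fun k => ?_, ?_,
          .mono (.opThen rfl (.iteFalse rfl rfl (.opThen rfl (.iteFalse rfl rfl (.opThen rfl
            (.opThen rfl (.opThen (he x y) (.iteTrue rfl (decide_eq_true hxy) (.opThen rfl
            (.callThen rfl rfl hev (.op rfl))))))))))) ?_⟩
        · rcases (hmem k).1 hk with h | h
          · exact hxa k h
          · rcases List.mem_cons.1 h with rfl | h
            · exact hxy
            · exact hxy.trans (hyb k h)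
        · simp only [List.mem_cons, hmem]; tauto
        · simp only [List.length_cons] at hlen ⊢; omega
        · simp only [List.length_cons]; omega
      · obtain ⟨c, hc, hmem, hlen, hev⟩ := iha ha' hb'
        refine ⟨x :: c, List.pairwise_cons.2 ⟨fun k hk => ?_, hc⟩, fun k => ?_, ?_,
          .mono (.opThen rfl (.iteFalse rfl rfl (.opThen rfl (.iteFalse rfl rfl (.opThen rfl
            (.opThen rfl (.opThen (he x x) (.iteFalse rfl (decide_eq_false (lt_irrefl x))
            (.opThen (he x x) (.iteFalse rfl (decide_eq_false (lt_irrefl x)) (.opThen rfl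
            (.opThen rfl (.callThen rfl rfl hev (.op rfl)))))))))))))) ?_⟩
        · rcases (hmem k).1 hk with h | h
          · exact hxa k h
          · exact hyb k h
        · simp only [List.mem_cons, hmem]; tauto
        · simp only [List.length_cons] at hlen ⊢; omega
        · simp only [List.length_cons]; omega
      · obtain ⟨c, hc, hmem, hlen, hev⟩ := ihb hb'
        refine ⟨y :: c, List.pairwise_cons.2 ⟨fun k hk => ?_, hc⟩, fun k => ?_, ?_,
          .mono (.opThen rfl (.iteFalse rfl rfl (.opThen rfl (.iteFalse rfl rfl (.opThen rfl
            (.opThen rfl (.opThen (he x y) (.iteFalse rfl (decide_eq_false hxy.not_gt)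
            (.opThen (he y x) (.iteTrue rfl (decide_eq_true hxy) (.opThen rfl
            (.callThen rfl rfl hev (.op rfl))))))))))))) ?_⟩
        · rcases (hmem k).1 hk with h | h
          · rcases List.mem_cons.1 h with rfl | h
            · exact hxy
            · exact hxy.trans (hxa k h)
          · exact hyb k h
        · simp only [List.mem_cons, hmem]; tauto
        · simp only [List.length_cons] at hlen ⊢; omega
        · simp only [List.length_cons]; omega

theorem evalsWithin_inter {a b : List K} (ha : a.Pairwise (· < ·)) (hb : b.Pairwise (· < ·)) :
    ∃ c : List K, c.Pairwise (· < ·) ∧ (∀ k, k ∈ c ↔ k ∈ a ∧ k ∈ b) ∧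
      c.length ≤ a.length + b.length ∧
      EvalsWithin U funTable [listVal e a, listVal e b] Body.inter (listVal e c)
        (40 * (a.length + b.length + 1)) := by
  induction a generalizing b with
  | nil =>
    exact ⟨[], .nil, by simp, by simp,
      .mono (.opThen rfl (.iteTrue rfl rfl (.op rfl))) (by simp; omega)⟩
  | cons x a iha =>
    induction b with
    | nil =>
      exact ⟨[], .nil, by simp, by simp, .mono (.opThen rfl (.iteFalse rfl rfl
        (.opThen rfl (.iteTrue rfl rfl (.op rfl))))) (by simp; omega)⟩
    | cons y b ihb =>
      obtain ⟨hxa, ha'⟩ := List.pairwise_cons.1 ha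
      obtain ⟨hyb, hb'⟩ := List.pairwise_cons.1 hb
      rcases lt_trichotomy x y with hxy | rfl | hxy
      · obtain ⟨c, hc, hmem, hlen, hev⟩ := iha ha' hb
        refine ⟨c, hc, fun k => ?_, ?_,
          .mono (.opThen rfl (.iteFalse rfl rfl (.opThen rfl (.iteFalse rfl rfl (.opThen rfl
            (.opThen rfl (.opThen (he x y) (.iteTrue rfl (decide_eq_true hxy) (.opThen rfl
            (.call rfl rfl hev)))))))))) ?_⟩
        · have hx : k = x → k ∉ y :: b := by
            rintro rfl h
            rcases List.mem_cons.1 h with rfl | h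
            · exact lt_irrefl _ hxy
            · exact lt_asymm hxy (hyb k h)
          simp only [hmem, List.mem_cons (b := x)]; tauto
        · simp only [List.length_cons] at hlen ⊢; omega
        · simp only [List.length_cons]; omega
      · obtain ⟨c, hc, hmem, hlen, hev⟩ := iha ha' hb'
        refine ⟨x :: c, List.pairwise_cons.2 ⟨fun k hk => hxa k ((hmem k).1 hk).1, hc⟩,
          fun k => ?_, ?_,
          .mono (.opThen rfl (.iteFalse rfl rfl (.opThen rfl (.iteFalse rfl rfl (.opThen rfl
            (.opThen rfl (.opThen (he x x) (.iteFalse rfl (decide_eq_false (lt_irrefl x))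
            (.opThen (he x x) (.iteFalse rfl (decide_eq_false (lt_irrefl x)) (.opThen rfl
            (.opThen rfl (.callThen rfl rfl hev (.op rfl)))))))))))))) ?_⟩
        · simp only [List.mem_cons, hmem]; tauto
        · simp only [List.length_cons] at hlen ⊢; omega
        · simp only [List.length_cons]; omega
      · obtain ⟨c, hc, hmem, hlen, hev⟩ := ihb hb'
        refine ⟨c, hc, fun k => ?_, ?_,
          .mono (.opThen rfl (.iteFalse rfl rfl (.opThen rfl (.iteFalse rfl rfl (.opThen rfl
            (.opThen rfl (.opThen (he x y) (.iteFalse rfl (decide_eq_false hxy.not_gt)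
            (.opThen (he y x) (.iteTrue rfl (decide_eq_true hxy) (.opThen rfl
            (.call rfl rfl hev)))))))))))) ?_⟩
        · have hy : k = y → k ∉ x :: a := by
            rintro rfl h
            rcases List.mem_cons.1 h with rfl | h
            · exact lt_irrefl _ hxy
            · exact lt_asymm hxy (hxa k h)
          simp only [hmem, List.mem_cons (b := y)]; tauto
        · simp only [List.length_cons] at hlen ⊢; omega
        · simp only [List.length_cons]; omega

open Classical in
theorem evalsWithin_subset {a b : List K} (ha : a.Pairwise (· < ·)) (hb : b.Pairwise (· < ·)) :
    EvalsWithin U funTable [listVal e a, listVal e b] Body.subset (.bool (decide (a ⊆ b)))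
      (40 * (a.length + b.length + 1)) := by
  induction a generalizing b with
  | nil =>
    rw [decide_eq_true (List.nil_subset b)]
    exact .mono (.opThen rfl (.iteTrue rfl rfl (.op rfl))) (by simp; omega)
  | cons x a iha =>
    induction b with
    | nil =>
      rw [decide_eq_false (by simp)]
      exact .mono (.opThen rfl (.iteFalse rfl rfl (.opThen rfl (.iteTrue rfl rfl (.op rfl)))))
        (by simp; omega)
    | cons y b ihb =>
      obtain ⟨hxa, ha'⟩ := List.pairwise_cons.1 ha
      obtain ⟨hyb, hb'⟩ := List.pairwise_cons.1 hb
      rcases lt_trichotomy x y with hxy | rfl | hxy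
      · have hx : ¬ x :: a ⊆ y :: b := fun h => by
          rcases List.mem_cons.1 (h List.mem_cons_self) with rfl | h
          · exact lt_irrefl _ hxy
          · exact lt_asymm hxy (hyb x h)
        rw [decide_eq_false hx]
        exact .mono (.opThen rfl (.iteFalse rfl rfl (.opThen rfl (.iteFalse rfl rfl (.opThen rfl
          (.opThen rfl (.opThen (he x y) (.iteTrue rfl (decide_eq_true hxy) (.op rfl)))))))))
          (by simp only [List.length_cons]; omega)
      · have hsub : x :: a ⊆ x :: b ↔ a ⊆ b := by
          rw [List.cons_subset]
          refine ⟨fun h k hk => (List.mem_cons.1 (h.2 hk)).resolve_left (hxa k hk).ne',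
            fun h => ⟨List.mem_cons_self, fun _ hk => List.mem_cons_of_mem _ (h hk)⟩⟩
        simp only [hsub]
        exact .mono (.opThen rfl (.iteFalse rfl rfl (.opThen rfl (.iteFalse rfl rfl (.opThen rfl
          (.opThen rfl (.opThen (he x x) (.iteFalse rfl (decide_eq_false (lt_irrefl x))
          (.opThen (he x x) (.iteFalse rfl (decide_eq_false (lt_irrefl x)) (.opThen rfl
          (.opThen rfl (.call rfl rfl (iha ha' hb'))))))))))))))
          (by simp only [List.length_cons]; omega)
      · have hsub : x :: a ⊆ y :: b ↔ x :: a ⊆ b := by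
          refine ⟨fun h k hk => (List.mem_cons.1 (h hk)).resolve_left ?_,
            fun h _ hk => List.mem_cons_of_mem _ (h hk)⟩
          rcases List.mem_cons.1 hk with rfl | hk
          · exact hxy.ne'
          · exact (hxy.trans (hxa k hk)).ne'
        simp only [hsub]
        exact .mono (.opThen rfl (.iteFalse rfl rfl (.opThen rfl (.iteFalse rfl rfl (.opThen rfl
          (.opThen rfl (.opThen (he x y) (.iteFalse rfl (decide_eq_false hxy.not_gt)
          (.opThen (he y x) (.iteTrue rfl (decide_eq_true hxy) (.opThen rfl
          (.call rfl rfl (ihb hb')))))))))))))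
          (by simp only [List.length_cons]; omega)

open Classical in
theorem evalsWithin_member (k : K) {t : BinaryTree K} (ht : (inorder t).Pairwise (· < ·)) :
    EvalsWithin U funTable [e k, treeVal e t] Body.member (.bool (decide (k ∈ inorder t)))
      (20 * (t.height + 1)) := by
  induction t with
  | nil =>
    rw [decide_eq_false (by simp [inorder])]
    exact .mono (.opThen rfl (.iteTrue rfl rfl (.op rfl))) (by simp)
  | node k' l r ihl ihr =>
    rw [inorder, List.pairwise_append, List.pairwise_cons] at ht
    obtain ⟨hl, ⟨hkr, hr⟩, hlr⟩ := ht
    have hl_lt : ∀ x ∈ inorder l, x < k' := fun x hx => hlr x hx k' List.mem_cons_self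
    have hmem : k ∈ inorder (.node k' l r) ↔ k ∈ inorder l ∨ k = k' ∨ k ∈ inorder r := by
      simp [inorder]
    rcases lt_trichotomy k k' with h | rfl | h
    · have : k ∈ inorder (.node k' l r) ↔ k ∈ inorder l := by
        rw [hmem]
        refine or_iff_left ?_
        rintro (rfl | h')
        · exact lt_irrefl _ h
        · exact lt_asymm h (hkr k h')
      simp only [this]
      exact .mono (.opThen rfl (.iteFalse rfl rfl (.opThen rfl (.opThen rfl (.opThen (he k k')
        (.iteTrue rfl (decide_eq_true h) (.opThen rfl (.call rfl rfl (ihl hl)))))))))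
        (by simp only [BinaryTree.height]; omega)
    · rw [decide_eq_true (hmem.2 (.inr (.inl rfl)))]
      exact .mono (.opThen rfl (.iteFalse rfl rfl (.opThen rfl (.opThen rfl (.opThen (he k k)
        (.iteFalse rfl (decide_eq_false (lt_irrefl k)) (.opThen (he k k)
        (.iteFalse rfl (decide_eq_false (lt_irrefl k)) (.op rfl)))))))))
        (by simp only [BinaryTree.height]; omega)
    · have : k ∈ inorder (.node k' l r) ↔ k ∈ inorder r := by
        rw [hmem]
        refine ⟨?_, fun h' => .inr (.inr h')⟩
        rintro (h' | rfl | h')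
        · exact absurd (hl_lt k h') h.not_gt
        · exact absurd h (lt_irrefl _)
        · exact h'
      simp only [this]
      exact .mono (.opThen rfl (.iteFalse rfl rfl (.opThen rfl (.opThen rfl (.opThen (he k k')
        (.iteFalse rfl (decide_eq_false h.not_gt) (.opThen (he k' k)
        (.iteTrue rfl (decide_eq_true h) (.opThen rfl (.call rfl rfl (ihr hr)))))))))))
        (by simp only [BinaryTree.height]; omega)

open Classical in
theorem evalsWithin_allMember (t : BinaryTree K) {s : BinaryTree K}
    (hs : (inorder s).Pairwise (· < ·)) :
    EvalsWithin U funTable [treeVal e t, treeVal e s] Body.allMember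
      (.bool (decide (inorder t ⊆ inorder s)))
      ((2 * t.numNodes + 1) * (20 * (s.height + 2))) := by
  induction t with
  | nil =>
    rw [decide_eq_true (by simp [inorder])]
    exact .mono (.opThen rfl (.iteTrue rfl rfl (.op rfl)))
      (by simp only [BinaryTree.numNodes]; omega)
  | node k l r ihl ihr =>
    have hcost : (2 * (BinaryTree.node k l r).numNodes + 1) * (20 * (s.height + 2)) =
        (2 * l.numNodes + 1) * (20 * (s.height + 2)) +
          (2 * r.numNodes + 1) * (20 * (s.height + 2)) + 20 * (s.height + 2) := by
      simp only [BinaryTree.numNodes]; ring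
    have hmem := evalsWithin_member he k hs
    have hsub : inorder (.node k l r) ⊆ inorder s ↔
        inorder l ⊆ inorder s ∧ k ∈ inorder s ∧ inorder r ⊆ inorder s := by
      rw [inorder, List.append_subset, List.cons_subset]
    rw [hcost]
    by_cases hk : k ∈ inorder s
    · by_cases hl : inorder l ⊆ inorder s
      · have : inorder (.node k l r) ⊆ inorder s ↔ inorder r ⊆ inorder s := by
          rw [hsub]; tauto
        simp only [this]
        exact .mono (.opThen rfl (.iteFalse rfl rfl (.opThen rfl (.callThen rfl rfl hmem
          (.iteTrue rfl (decide_eq_true hk) (.opThen rfl (.opThen rfl (.callThen rfl rfl ihl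
          (.iteTrue rfl (decide_eq_true hl) (.opThen rfl (.call rfl rfl ihr)))))))))))
          (by omega)
      · rw [decide_eq_false (fun h => hl (hsub.1 h).1)]
        exact .mono (.opThen rfl (.iteFalse rfl rfl (.opThen rfl (.callThen rfl rfl hmem
          (.iteTrue rfl (decide_eq_true hk) (.opThen rfl (.opThen rfl (.callThen rfl rfl ihl
          (.iteFalse rfl (decide_eq_false hl) (.op rfl))))))))))
          (by omega)
    · rw [decide_eq_false (fun h => hk (hsub.1 h).2.1)]
      exact .mono (.opThen rfl (.iteFalse rfl rfl (.opThen rfl (.callThen rfl rfl hmem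
        (.iteFalse rfl (decide_eq_false hk) (.op rfl)))))) (by omega)

end Sorted

/-- Halving the number of keys at each level keeps the tree balanced. -/
theorem evalsWithin_build (n : ℕ) (l : List K) (hn : n ≤ l.length) :
    ∃ r : BinaryTree K, inorder r = l.take n ∧ 2 ^ r.height ≤ max 1 (2 * n) ∧
      EvalsWithin U funTable [.num n, listVal e l] Body.build
        (.pair (treeVal e r) (listVal e (l.drop n))) (50 * (2 * n + 1)) := by
  induction n using Nat.strong_induction_on generalizing l with
  | _ n ih =>
    rcases Nat.eq_zero_or_pos n with rfl | hpos
    · exact ⟨.nil, rfl, by simp, .mono (.opThen rfl (.opThen rfl (.iteTrue rfl rfl (.opThen rfl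
        (.op rfl))))) (by omega)⟩
    · obtain ⟨r₁, hr₁, hh₁, hev₁⟩ := ih (n / 2) (by omega) l (by omega)
      obtain ⟨k, l', hl'⟩ : ∃ k l', l.drop (n / 2) = k :: l' :=
        List.exists_cons_of_ne_nil (by rw [ne_eq, List.drop_eq_nil_iff]; omega)
      have hlen : l.length - n / 2 = l'.length + 1 := by
        rw [← List.length_drop, hl', List.length_cons]
      obtain ⟨r₂, hr₂, hh₂, hev₂⟩ := ih (n - n / 2 - 1) (by omega) l' (by omega)
      have hsplit : l = l.take (n / 2) ++ k :: l' := by rw [← hl', List.take_append_drop]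
      have hlen₁ : (l.take (n / 2)).length = n / 2 := List.length_take_of_le (by omega)
      have hsucc : n - n / 2 = n - n / 2 - 1 + 1 := by omega
      have htake : l.take n = l.take (n / 2) ++ k :: l'.take (n - n / 2 - 1) := by
        conv_lhs => rw [hsplit, List.take_append, hlen₁, hsucc, List.take_succ_cons,
          List.take_of_length_le (by omega)]
      have hdrop : l.drop n = l'.drop (n - n / 2 - 1) := by
        conv_lhs => rw [hsplit, List.drop_append, hlen₁, hsucc, List.drop_succ_cons,
          List.drop_of_length_le (by omega), List.nil_append]
      refine ⟨.node k r₁ r₂, by rw [inorder, hr₁, hr₂, htake], ?_, ?_⟩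
      · have hle : 2 ^ max r₁.height r₂.height ≤ max 1 (2 * (n / 2)) := by
          rcases max_cases r₁.height r₂.height with ⟨h, _⟩ | ⟨h, _⟩ <;> rw [h] <;> omega
        rw [BinaryTree.height, pow_succ]
        omega
      · rw [hl'] at hev₁
        rw [hdrop]
        exact .mono (.opThen rfl (.opThen rfl (.iteFalse rfl (decide_eq_false (by omega))
          (.opThen rfl (.callThen rfl rfl hev₁ (.opThen rfl (.opThen rfl (.opThen rfl (.opThen rfl
          (.opThen rfl (.callThen rfl rfl hev₂ (.opThen rfl (.opThen rfl (.opThen rfl (.opThen rfl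
          (.opThen rfl (.opThen rfl (.op rfl))))))))))))))))))
          (by omega)

theorem evalsWithin_mkSet (l : List K) :
    ∃ r : BinaryTree K, inorder r = l ∧ 2 ^ r.height ≤ (r.numNodes + 1) ^ 2 ∧
      EvalsWithin U funTable [listVal e l] Body.mkSet (setVal e r) (200 * (l.length + 1)) := by
  obtain ⟨r, hr, hh, hev⟩ := evalsWithin_build (U := U) (e := e) l.length l le_rfl
  rw [List.take_length] at hr
  have hnum : r.numNodes = l.length := by rw [← length_inorder, hr]
  refine ⟨r, hr, ?_, ?_⟩
  · rw [hnum]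
    refine hh.trans (max_le ?_ ?_) <;> nlinarith
  · rw [setVal, hnum]
    exact .mono (.callThen rfl rfl (evalsWithin_length l) (.callThen rfl rfl hev (.opThen rfl
      (.op rfl)))) (by omega)

theorem evalsWithin_mulLog (m n : ℕ) :
    EvalsWithin U funTable [.num m, .num n] Body.mulLog (.num (m * Nat.log 2 n))
      (20 * (Nat.log 2 n + 1)) := by
  induction n using Nat.strong_induction_on with
  | _ n ih =>
    rcases Nat.lt_or_ge 1 n with hn | hn
    · have hlog : Nat.log 2 n = Nat.log 2 (n / 2) + 1 := Nat.log_of_one_lt_of_le (by norm_num) hn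
      have hval : m * Nat.log 2 n = m + m * Nat.log 2 (n / 2) := by rw [hlog]; ring
      rw [hval]
      exact .mono (.opThen rfl (.opThen rfl (.iteFalse rfl (decide_eq_false (by omega))
        (.opThen rfl (.callThen rfl rfl (ih (n / 2) (by omega)) (.op rfl)))))) (by omega)
    · have hlog : Nat.log 2 n = 0 := Nat.log_of_lt (by omega)
      rw [hlog]
      exact .mono (.opThen rfl (.opThen rfl (.iteTrue rfl (decide_eq_true hn) (.op rfl))))
        (by omega)

theorem evalsWithin_filter (P : Orb A → Bool) (l : List (Orb A))
    (hP : ∀ o ∈ l, U.pred (Quotient.out o) = some (P o)) :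
    EvalsWithin U funTable [listVal .orbA l] Body.filter (listVal .orbA (l.filter P))
      (30 * (l.length + 1)) := by
  induction l with
  | nil => exact .mono (.opThen rfl (.iteTrue rfl rfl (.op rfl))) (by simp)
  | cons o l ih =>
    have ih := ih fun o' ho' => hP o' (List.mem_cons_of_mem _ ho')
    have hcall : primResult U .callPred [.eltA (Quotient.out o)] = some (.bool (P o)) := by
      simp [primResult, hP o List.mem_cons_self]
    have hcost := List.length_cons (a := o) (as := l)
    cases hPo : P o with
    | true =>
      rw [List.filter_cons_of_pos hPo]
      exact .mono (.opThen rfl (.iteFalse rfl rfl (.opThen rfl (.opThen rfl (.opThen hcall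
        (.opThen rfl (.callThen rfl rfl ih (.iteTrue rfl hPo (.op rfl)))))))))
        (by omega)
    | false =>
      rw [List.filter_cons_of_neg (by simp [hPo])]
      exact .mono (.opThen rfl (.iteFalse rfl rfl (.opThen rfl (.opThen rfl (.opThen hcall
        (.opThen rfl (.callThen rfl rfl ih (.iteFalse rfl hPo (.var rfl)))))))))
        (by omega)

/-- Each node is merged once for each of its ancestors, hence the factor of the height. -/
theorem evalsWithin_image (φ : Orb A → B) (t : BinaryTree (Orb A))
    (hφ : ∀ o ∈ inorder t, U.fn (Quotient.out o) = some (φ o)) :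
    ∃ c : List (Orb B), c.Pairwise (· < ·) ∧ (∀ k, k ∈ c ↔ ∃ o ∈ inorder t, orbitOf (φ o) = k) ∧
      c.length ≤ t.numNodes ∧
      EvalsWithin U funTable [treeVal .orbA t] Body.image (listVal .orbB c)
        (200 * ((2 * t.numNodes + 1) * (t.height + 1))) := by
  induction t with
  | nil =>
    exact ⟨[], .nil, by simp [inorder], by simp,
      .mono (.opThen rfl (.iteTrue rfl rfl (.op rfl))) (by simp)⟩
  | node o l r ihl ihr =>
    simp only [inorder, List.mem_append, List.mem_cons] at hφ
    obtain ⟨c₁, hc₁, hmem₁, hlen₁, hev₁⟩ := ihl fun o' ho' => hφ o' (.inl ho')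
    obtain ⟨c₂, hc₂, hmem₂, hlen₂, hev₂⟩ := ihr fun o' ho' => hφ o' (.inr (.inr ho'))
    obtain ⟨c₃, hc₃, hmem₃, hlen₃, hev₃⟩ := evalsWithin_union (U := U) comparable_orbB hc₁
      (List.pairwise_singleton (· < ·) (orbitOf (φ o)))
    obtain ⟨c, hc, hmem, hlen, hev⟩ := evalsWithin_union (U := U) comparable_orbB hc₃ hc₂
    have hcall : primResult U .callFn [.eltA (Quotient.out o)] = some (.eltB (φ o)) := by
      simp [primResult, hφ o (.inr (.inl rfl))]
    refine ⟨c, hc, fun k => ?_, ?_, .mono (.opThen rfl (.iteFalse rfl rfl (.opThen rfl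
      (.opThen rfl (.opThen rfl (.callThen rfl rfl hev₁ (.opThen rfl (.callThen rfl rfl hev₂
      (.opThen rfl (.opThen hcall (.opThen rfl (.opThen rfl (.opThen rfl (.callThen rfl rfl hev₃
      (.call rfl rfl hev))))))))))))))) ?_⟩
    · rw [hmem, hmem₃, List.mem_singleton, hmem₁, hmem₂]
      simp only [inorder, List.mem_append, List.mem_cons, or_and_right, exists_or,
        exists_eq_left, or_assoc, eq_comm (a := k)]
    · simp only [List.length_singleton, BinaryTree.numNodes] at *
      omega
    · simp only [List.length_singleton, BinaryTree.numNodes, BinaryTree.height] at *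
      have h1 : (2 * l.numNodes + 1) * (l.height + 1) ≤
          (2 * l.numNodes + 1) * (max l.height r.height + 1) := by gcongr; exact le_max_left _ _
      have h2 : (2 * r.numNodes + 1) * (r.height + 1) ≤
          (2 * r.numNodes + 1) * (max l.height r.height + 1) := by gcongr; exact le_max_right _ _
      have h3 : (2 * (l.numNodes + r.numNodes + 1) + 1) * (max l.height r.height + 1 + 1) =
          (2 * l.numNodes + 1) * (max l.height r.height + 1) +
            (2 * r.numNodes + 1) * (max l.height r.height + 1) + (max l.height r.height + 1) +
            (2 * (l.numNodes + r.numNodes + 1) + 1) := by ring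
      omega

/-- The calls form a tree in which all inner nodes have three children, and whose leaves are the
strings. -/
theorem evalsWithin_strings (o : Orb A) (o' : Orb B) (w : List Letter) (m n : ℕ)
    (acc : List (ProdOrb A B)) :
    EvalsWithin U funTable
      [.orbA o, .orbB o', .word w, .num m, .num n, listVal prodOrbVal acc] Body.strings
      (listVal prodOrbVal ((strings m n).map (fun u => prodKey o o' (w ++ u)) ++ acc))
      (100 * (strings m n).length - 50) := by
  fun_induction strings m n generalizing w acc with
  | case1 n =>
    exact .mono (.opThen rfl (.opThen rfl (.iteTrue rfl (decide_eq_true le_rfl) (.opThen rfl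
      (.opThen rfl (.opThen rfl (.op rfl))))))) (by simp)
  | case2 m =>
    exact .mono (.opThen rfl (.opThen rfl (.iteFalse rfl (decide_eq_false (by omega))
      (.opThen rfl (.iteTrue rfl (decide_eq_true le_rfl) (.opThen rfl
      (.opThen rfl (.opThen rfl (.op rfl))))))))) (by simp)
  | case3 m n ih1 ih2 ih3 =>
    have h1 := length_strings_pos m (n + 1)
    have h2 := length_strings_pos (m + 1) n
    have h3 := length_strings_pos m n
    have key : ∀ (a : Letter) (l : List (List Letter)),
        (l.map (a :: ·)).map (fun u => prodKey o o' (w ++ u)) =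
          l.map fun u => prodKey o o' (w ++ List.replicate 1 a ++ u) := by
      intro a l
      simp
    rw [List.map_append, List.map_append, key, key, key, List.append_assoc, List.append_assoc]
    exact .mono (.opThen rfl (.opThen rfl (.iteFalse rfl (decide_eq_false (by omega))
      (.opThen rfl (.iteFalse rfl (decide_eq_false (by omega)) (.opThen rfl (.opThen rfl
      (.opThen rfl (.opThen rfl (.callThen rfl rfl (ih3 _ acc) (.opThen rfl
      (.callThen rfl rfl (ih2 _ _) (.opThen rfl (.call rfl rfl (ih1 _ _))))))))))))))) (by
        simp only [List.length_append, List.length_map]; omega)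

theorem evalsWithin_prodOne (o : Orb A) (s : BinaryTree (Orb B)) (acc : List (ProdOrb A B)) :
    EvalsWithin U funTable [.orbA o, treeVal .orbB s, listVal prodOrbVal acc] Body.prodOne
      (listVal prodOrbVal ((inorder s).flatMap (prodKeys o) ++ acc))
      (200 * ((inorder s).flatMap (prodKeys o)).length + 50) := by
  induction s generalizing acc with
  | nil => exact .mono (.opThen rfl (.iteTrue rfl rfl (.var rfl))) (by simp)
  | node o' l r ihl ihr =>
    have hpos := length_prodKeys_pos o o'
    have hstr := evalsWithin_strings (U := U) o o' [] (dim (Quotient.out o))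
      (dim (Quotient.out o')) ((inorder r).flatMap (prodKeys o) ++ acc)
    rw [← length_prodKeys] at hstr
    rw [inorder, List.flatMap_append, List.flatMap_cons, List.append_assoc, List.append_assoc]
    exact .mono (.opThen rfl (.iteFalse rfl rfl (.opThen rfl (.opThen rfl (.opThen rfl
      (.callThen rfl rfl (ihr acc) (.opThen rfl (.opThen rfl (.opThen rfl
      (.callThen rfl rfl hstr (.opThen rfl (.call rfl rfl (ihl _)))))))))))))
      (by simp only [List.length_append]; omega)

/-- The cost is linear in the length of the result because each orbit in the first tree contributes
to the result, the second tree not being empty. -/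
theorem evalsWithin_prod (t : BinaryTree (Orb A)) {s : BinaryTree (Orb B)} (hs : 0 < s.numNodes)
    (acc : List (ProdOrb A B)) :
    EvalsWithin U funTable [treeVal .orbA t, treeVal .orbB s, listVal prodOrbVal acc] Body.prod
      (listVal prodOrbVal ((inorder t).flatMap (fun o => (inorder s).flatMap (prodKeys o)) ++ acc))
      (400 * ((inorder t).flatMap fun o => (inorder s).flatMap (prodKeys o)).length + 50) := by
  induction t generalizing acc with
  | nil => exact .mono (.opThen rfl (.iteTrue rfl rfl (.var rfl))) (by simp)
  | node o l r ihl ihr =>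
    have hpos : 0 < ((inorder s).flatMap (prodKeys o)).length := by
      obtain ⟨o', ho'⟩ : ∃ o', o' ∈ inorder s :=
        List.exists_mem_of_length_pos (by rwa [length_inorder])
      obtain ⟨k, hk⟩ := List.exists_mem_of_length_pos (length_prodKeys_pos o o')
      exact List.length_pos_of_mem (List.mem_flatMap.2 ⟨o', ho', hk⟩)
    rw [inorder, List.flatMap_append, List.flatMap_cons, List.append_assoc, List.append_assoc]
    exact .mono (.opThen rfl (.iteFalse rfl rfl (.opThen rfl (.opThen rfl
      (.callThen rfl rfl (ihr acc) (.opThen rfl (.callThen rfl rfl (evalsWithin_prodOne o s _)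
      (.opThen rfl (.call rfl rfl (ihl _))))))))))
      (by simp only [List.length_append]; omega)

end Functions

/-! ### Trees of orbits -/

/-- The height of a balanced tree is logarithmic. -/
theorem height_le_of_balanced {h n : ℕ} (hb : 2 ^ h ≤ (n + 1) ^ 2) : h ≤ 2 * Nat.log 2 n + 2 := by
  have h1 : n + 1 ≤ 2 ^ (Nat.log 2 n + 1) := Nat.lt_pow_succ_log_self (by norm_num) n
  have h2 : 2 ^ h ≤ 2 ^ (2 * Nat.log 2 n + 2) := by
    calc 2 ^ h ≤ (n + 1) ^ 2 := hb
      _ ≤ (2 ^ (Nat.log 2 n + 1)) ^ 2 := Nat.pow_le_pow_left h1 2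
      _ = 2 ^ (2 * Nat.log 2 n + 2) := by rw [← pow_mul]; ring_nf
  exact (Nat.pow_le_pow_iff_right (by norm_num)).1 h2

theorem length_eq_ncard {K : Type*} [LinearOrder K] {l : List K} {S : Set K}
    (hl : l.Pairwise (· < ·)) (hS : ∀ k, k ∈ l ↔ k ∈ S) : l.length = S.ncard := by
  have : S = (l.toFinset : Set K) := by ext k; simp [hS]
  rw [this, Set.ncard_coe_finset, List.toFinset_card_of_nodup (hl.imp fun h => h.ne)]

section Trees

variable {A B : Type*} [MulAction MonoAut A] [MulAction MonoAut B]
  [LinearOrder (Orb A)] [LinearOrder (Orb B)]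

theorem IsTreeOf.mem_inorder {X : Set A} {t : BinaryTree (Orb A)} (ht : IsTreeOf orbitOf X t)
    (o : Orb A) : o ∈ inorder t ↔ o ∈ orbitOf '' X :=
  ht.keys o

theorem IsTreeOf.orbitOf_mem_inorder {X : Set A} {t : BinaryTree (Orb A)}
    (hX : IsOrbitFiniteNominal X) (ht : IsTreeOf orbitOf X t) {x : A} :
    orbitOf x ∈ inorder t ↔ x ∈ X :=
  (ht.mem_inorder _).trans hX.orbitOf_mem_image

theorem IsTreeOf.inorder_subset_iff {X Y : Set A} {t s : BinaryTree (Orb A)}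
    (hX : IsOrbitFiniteNominal X) (ht : IsTreeOf orbitOf X t) (hY : IsOrbitFiniteNominal Y)
    (hs : IsTreeOf orbitOf Y s) : inorder t ⊆ inorder s ↔ X ⊆ Y := by
  constructor
  · exact fun h x hx => (hs.orbitOf_mem_inorder hY).1 (h ((ht.orbitOf_mem_inorder hX).2 hx))
  · intro h o ho
    obtain ⟨x, hx, rfl⟩ := (ht.mem_inorder o).1 ho
    exact (hs.orbitOf_mem_inorder hY).2 (h hx)

theorem IsTreeOf.height_le {Z K : Type*} [MulAction MonoAut Z] [LinearOrder K] {code : Z → K}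
    {X : Set Z} {t : BinaryTree K} (ht : IsTreeOf code X t) :
    t.height ≤ 2 * Nat.log 2 t.numNodes + 2 :=
  height_le_of_balanced ht.balanced

/-- A tree of the members of a list is a tree of the set whose orbits are listed. -/
theorem isTreeOf_orbitOf {X : Set A} {r : BinaryTree (Orb A)} {l : List (Orb A)}
    (hr : inorder r = l) (hb : 2 ^ r.height ≤ (r.numNodes + 1) ^ 2) (hl : l.Pairwise (· < ·))
    (hmem : ∀ o, o ∈ l ↔ ∃ x ∈ X, orbitOf x = o) : IsTreeOf orbitOf X r where
  sorted := hr ▸ hl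
  balanced := hb
  keys := hr ▸ hmem
  size := by rw [← length_inorder, hr, numOrbits, length_eq_ncard hl hmem]; rfl

theorem evalsWithin_flatten_nil {U : UserFns A B} {K : Type*} {e : K → Val A B}
    (t : BinaryTree K) :
    EvalsWithin U funTable [treeVal e t, .nil] Body.flatten (listVal e (inorder t))
      (20 * (2 * t.numNodes + 1)) := by
  simpa only [List.append_nil, listVal] using evalsWithin_flatten (U := U) (e := e) t []

/-! ### Evaluation of the programs -/

section Programs

variable {U : UserFns A B} {X Y : Set A} {t s : BinaryTree (Orb A)}

open Classical in
theorem evalsWithin_test (hX : IsOrbitFiniteNominal X) (ht : IsTreeOf orbitOf X t) (x : A) :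
    EvalsWithin U funTable [.eltA x, setVal .orbA t] Main.test (.bool (decide (x ∈ X)))
      (1000 * (1 + Nat.log 2 (numOrbits X))) := by
  have hev := evalsWithin_member (U := U) comparable_orbA (orbitOf x) ht.sorted
  rw [decide_eq_decide.2 (ht.orbitOf_mem_inorder hX)] at hev
  rw [← ht.size]
  have hheight := ht.height_le
  exact .mono (.opThen rfl (.opThen rfl (.call rfl rfl hev))) (by omega)

open Classical in
theorem evalsWithin_incl (hX : IsOrbitFiniteNominal X) (ht : IsTreeOf orbitOf X t)
    (hY : IsOrbitFiniteNominal Y) (hs : IsTreeOf orbitOf Y s) :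
    EvalsWithin U funTable [setVal .orbA t, setVal .orbA s] Main.incl (.bool (decide (X ⊆ Y)))
      (1000 * (1 + min (numOrbits X + numOrbits Y)
        (numOrbits X * Nat.log 2 (numOrbits Y)))) := by
  have hiff := ht.inorder_subset_iff hX hY hs
  rw [← ht.size, ← hs.size]
  have hlog := Nat.log_le_self 2 s.numNodes
  by_cases hle : t.numNodes ≤ s.numNodes
  · rcases Nat.eq_zero_or_pos t.numNodes with h0 | hpos
    · have hnil : inorder t = [] := List.length_eq_zero_iff.1 ((length_inorder t).trans h0)
      rw [decide_eq_true (hiff.1 (hnil ▸ List.nil_subset _))]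
      exact .mono (.opThen rfl (.opThen rfl (.opThen rfl (.opThen rfl (.opThen rfl (.iteTrue rfl
        (decide_eq_true hle) (.opThen rfl (.opThen rfl (.iteTrue rfl (decide_eq_true h0.le)
        (.op rfl)))))))))) (by omega)
    · -- the computation of the logarithm stays within both bounds, as there is an orbit in `X`
      have hlog' : Nat.log 2 s.numNodes ≤ t.numNodes * Nat.log 2 s.numNodes :=
        Nat.le_mul_of_pos_left _ hpos
      by_cases hc : t.numNodes + s.numNodes ≤ t.numNodes * Nat.log 2 s.numNodes
      · have hev := evalsWithin_subset (U := U) comparable_orbA ht.sorted hs.sorted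
        rw [decide_eq_decide.2 hiff, length_inorder, length_inorder] at hev
        exact .mono (.opThen rfl (.opThen rfl (.opThen rfl (.opThen rfl (.opThen rfl (.iteTrue rfl
          (decide_eq_true hle) (.opThen rfl (.opThen rfl (.iteFalse rfl
          (decide_eq_false (by omega)) (.callThen rfl rfl (evalsWithin_mulLog _ _) (.opThen rfl
          (.opThen rfl (.iteTrue rfl (decide_eq_true hc) (.opThen rfl
          (.callThen rfl rfl (evalsWithin_flatten_nil t)
          (.callThen rfl rfl (evalsWithin_flatten_nil s)
          (.call rfl rfl hev)))))))))))))))))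
          (by rw [min_eq_left hc]; omega)
      · have hheight := hs.height_le
        -- if `Y` has a single orbit, then so does `X`
        have hcost : (2 * t.numNodes + 1) * (20 * (s.height + 2)) ≤
            400 * (1 + t.numNodes * Nat.log 2 s.numNodes) := by
          rcases Nat.eq_zero_or_pos (Nat.log 2 s.numNodes) with hz | hz
          · have hs1 : s.numNodes < 2 := by
              rcases Nat.log_eq_zero_iff.1 hz with h | h <;> omega
            have ht1 : t.numNodes = 1 := by omega
            rw [hz] at hheight ⊢
            rw [ht1]
            omega
          · have h1 : s.height + 2 ≤ 6 * Nat.log 2 s.numNodes := by omega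
            calc (2 * t.numNodes + 1) * (20 * (s.height + 2))
                ≤ (3 * t.numNodes) * (20 * (6 * Nat.log 2 s.numNodes)) := by gcongr; omega
              _ = 360 * (t.numNodes * Nat.log 2 s.numNodes) := by ring
              _ ≤ _ := by omega
        have hev := evalsWithin_allMember (U := U) comparable_orbA t hs.sorted
        rw [decide_eq_decide.2 hiff] at hev
        exact .mono (.opThen rfl (.opThen rfl (.opThen rfl (.opThen rfl (.opThen rfl (.iteTrue rfl
          (decide_eq_true hle) (.opThen rfl (.opThen rfl (.iteFalse rfl
          (decide_eq_false (by omega)) (.callThen rfl rfl (evalsWithin_mulLog _ _) (.opThen rfl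
          (.opThen rfl (.iteFalse rfl (decide_eq_false hc)
          (.call rfl rfl hev))))))))))))))
          (by rw [min_eq_right (not_le.1 hc).le]; omega)
  · have hnot : ¬ inorder t ⊆ inorder s := fun h => hle <| by
      rw [← length_inorder, ← length_inorder]
      exact (List.Nodup.subperm (ht.sorted.imp ne_of_lt) h).length_le
    rw [decide_eq_false (mt hiff.2 hnot)]
    exact .mono (.opThen rfl (.opThen rfl (.opThen rfl (.opThen rfl (.opThen rfl (.iteFalse rfl
      (decide_eq_false hle) (.op rfl))))))) (by omega)

theorem evalsWithin_main_union (ht : IsTreeOf orbitOf X t) (hs : IsTreeOf orbitOf Y s) :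
    ∃ r, IsTreeOf orbitOf (X ∪ Y) r ∧
      EvalsWithin U funTable [setVal .orbA t, setVal .orbA s] Main.union (setVal .orbA r)
        (1000 * (1 + (numOrbits X + numOrbits Y))) := by
  obtain ⟨c, hc, hmem, hlen, hev⟩ :=
    evalsWithin_union (U := U) comparable_orbA ht.sorted hs.sorted
  obtain ⟨r, hr, hb, hev'⟩ := evalsWithin_mkSet (U := U) (e := .orbA) c
  refine ⟨r, isTreeOf_orbitOf hr hb hc fun o => ?_, ?_⟩
  · rw [hmem, ht.keys, hs.keys]
    simp only [Set.mem_union, or_and_right, exists_or]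
  · rw [length_inorder, length_inorder] at hlen hev
    rw [← ht.size, ← hs.size]
    exact .mono (.opThen rfl (.opThen rfl (.opThen rfl
      (.callThen rfl rfl (evalsWithin_flatten_nil t) (.callThen rfl rfl (evalsWithin_flatten_nil s)
      (.callThen rfl rfl hev (.call rfl rfl hev'))))))) (by omega)

theorem evalsWithin_main_inter (hX : IsOrbitFiniteNominal X) (ht : IsTreeOf orbitOf X t)
    (hs : IsTreeOf orbitOf Y s) :
    ∃ r, IsTreeOf orbitOf (X ∩ Y) r ∧
      EvalsWithin U funTable [setVal .orbA t, setVal .orbA s] Main.inter (setVal .orbA r)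
        (1000 * (1 + (numOrbits X + numOrbits Y))) := by
  obtain ⟨c, hc, hmem, hlen, hev⟩ :=
    evalsWithin_inter (U := U) comparable_orbA ht.sorted hs.sorted
  obtain ⟨r, hr, hb, hev'⟩ := evalsWithin_mkSet (U := U) (e := .orbA) c
  refine ⟨r, isTreeOf_orbitOf hr hb hc fun o => ?_, ?_⟩
  · rw [hmem, ht.keys, hs.keys]
    constructor
    · rintro ⟨⟨x, hx, rfl⟩, ⟨y, hy, hxy⟩⟩
      exact ⟨y, ⟨hX.mem_of_orbitOf_eq hx hxy, hy⟩, hxy⟩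
    · rintro ⟨x, ⟨hx, hy⟩, rfl⟩
      exact ⟨⟨x, hx, rfl⟩, ⟨x, hy, rfl⟩⟩
  · rw [length_inorder, length_inorder] at hlen hev
    rw [← ht.size, ← hs.size]
    exact .mono (.opThen rfl (.opThen rfl (.opThen rfl
      (.callThen rfl rfl (evalsWithin_flatten_nil t) (.callThen rfl rfl (evalsWithin_flatten_nil s)
      (.callThen rfl rfl hev (.call rfl rfl hev'))))))) (by omega)

theorem evalsWithin_main_filter (hX : IsOrbitFiniteNominal X) (ht : IsTreeOf orbitOf X t)
    (p : X → Bool) (hp : ∀ (g : MonoAut) (x y : X), (y : A) = g • (x : A) → p y = p x)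
    (hU : ∀ x : X, U.pred x = some (p x)) :
    ∃ r, IsTreeOf orbitOf {x : A | ∃ h : x ∈ X, p ⟨x, h⟩ = true} r ∧
      EvalsWithin U funTable [setVal .orbA t] Main.filter (setVal .orbA r)
        (1000 * (1 + numOrbits X)) := by
  classical
  have hout : ∀ {o}, o ∈ inorder t → Quotient.out o ∈ X := fun {o} ho =>
    (ht.orbitOf_mem_inorder hX).1 (by rwa [orbitOf_out])
  -- the predicate on orbits, with a default value outside of `X`
  let P : Orb A → Bool := fun o => if h : Quotient.out o ∈ X then p ⟨_, h⟩ else false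
  have hP : ∀ (x : A) (hx : x ∈ X), P (orbitOf x) = p ⟨x, hx⟩ := by
    intro x hx
    have h := hout ((ht.orbitOf_mem_inorder hX).2 hx)
    obtain ⟨g, hg⟩ := orbitOf_eq_iff.1 (orbitOf_out (orbitOf x))
    simp only [P, dif_pos h]
    exact hp g ⟨x, hx⟩ ⟨_, h⟩ hg.symm
  have hev := evalsWithin_filter (U := U) P (inorder t) fun o ho => by
    simp only [P, dif_pos (hout ho)]
    exact hU ⟨_, hout ho⟩
  obtain ⟨r, hr, hb, hev'⟩ := evalsWithin_mkSet (U := U) (e := .orbA) ((inorder t).filter P)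
  refine ⟨r, isTreeOf_orbitOf hr hb (ht.sorted.filter _) fun o => ?_, ?_⟩
  · rw [List.mem_filter, ht.keys]
    constructor
    · rintro ⟨⟨x, hx, rfl⟩, h⟩
      exact ⟨x, ⟨hx, (hP x hx).symm.trans h⟩, rfl⟩
    · rintro ⟨x, ⟨hx, h⟩, rfl⟩
      exact ⟨⟨x, hx, rfl⟩, (hP x hx).trans h⟩
  · have hlen := List.length_filter_le P (inorder t)
    rw [length_inorder] at hlen hev
    rw [← ht.size]
    exact .mono (.opThen rfl (.opThen rfl (.callThen rfl rfl (evalsWithin_flatten_nil t)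
      (.callThen rfl rfl hev (.call rfl rfl hev'))))) (by omega)

theorem evalsWithin_main_image (hX : IsOrbitFiniteNominal X) (ht : IsTreeOf orbitOf X t)
    (f : X → B) (hf : ∀ (g : MonoAut) (x y : X), (y : A) = g • (x : A) → f y = g • f x)
    (hU : ∀ x : X, U.fn x = some (f x)) :
    ∃ r, IsTreeOf orbitOf (Set.range f) r ∧
      EvalsWithin U funTable [setVal .orbA t] Main.image (setVal .orbB r)
        (10000 * (1 + numOrbits X * Nat.log 2 (numOrbits X))) := by
  classical
  have hout : ∀ {o}, o ∈ inorder t → Quotient.out o ∈ X := fun {o} ho =>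
    (ht.orbitOf_mem_inorder hX).1 (by rwa [orbitOf_out])
  rcases Set.eq_empty_or_nonempty X with rfl | ⟨x₀, hx₀⟩
  · -- no default value for `f` is at hand here
    have htnil : t = .nil := by
      cases t with
      | nil => rfl
      | node o l r => exact absurd (hout (o := o) (by simp [inorder])) (Set.notMem_empty _)
    subst htnil
    obtain ⟨r, hr, hb, hev'⟩ := evalsWithin_mkSet (U := U) (e := .orbB) []
    refine ⟨r, isTreeOf_orbitOf hr hb .nil fun o => by simp, ?_⟩
    have hev : EvalsWithin U funTable [(.nil : Val A B)] Body.image .nil 10 :=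
      .mono (.opThen rfl (.iteTrue rfl rfl (.op rfl))) (by norm_num)
    exact .mono (.opThen rfl (.callThen rfl rfl hev (.call rfl rfl hev'))) (by
      simp only [List.length_nil]; omega)
  · let φ : Orb A → B := fun o => if h : Quotient.out o ∈ X then f ⟨_, h⟩ else f ⟨x₀, hx₀⟩
    obtain ⟨c, hc, hmem, hlen, hev⟩ := evalsWithin_image (U := U) φ t fun o ho => by
      simp only [φ, dif_pos (hout ho)]
      exact hU ⟨_, hout ho⟩
    obtain ⟨r, hr, hb, hev'⟩ := evalsWithin_mkSet (U := U) (e := .orbB) c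
    refine ⟨r, isTreeOf_orbitOf hr hb hc fun k => ?_, ?_⟩
    · rw [hmem]
      constructor
      · rintro ⟨o, ho, rfl⟩
        simp only [φ, dif_pos (hout ho)]
        exact ⟨_, ⟨_, rfl⟩, rfl⟩
      · rintro ⟨_, ⟨⟨x, hx⟩, rfl⟩, rfl⟩
        have ho := (ht.orbitOf_mem_inorder hX).2 hx
        refine ⟨orbitOf x, ho, ?_⟩
        obtain ⟨g, hg⟩ := orbitOf_eq_iff.1 (orbitOf_out (orbitOf x))
        simp only [φ, dif_pos (hout ho)]
        rw [hf g ⟨x, hx⟩ ⟨_, hout ho⟩ hg.symm, orbitOf_smul]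
    · rw [← ht.size]
      have hheight := ht.height_le
      -- at most one orbit, or a logarithm that is positive and so absorbs constants
      have hcost : (2 * t.numNodes + 1) * (t.height + 1) + t.numNodes ≤
          20 * (1 + t.numNodes * Nat.log 2 t.numNodes) := by
        rcases Nat.eq_zero_or_pos (Nat.log 2 t.numNodes) with hz | hz
        · have ht1 : t.numNodes ≤ 1 := by
            rcases Nat.log_eq_zero_iff.1 hz with h | h <;> omega
          rw [hz] at hheight ⊢
          calc (2 * t.numNodes + 1) * (t.height + 1) + t.numNodes
              ≤ (2 * 1 + 1) * (2 * 0 + 2 + 1) + 1 := by gcongr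
            _ ≤ _ := by omega
        · have h1 : t.height + 1 ≤ 5 * Nat.log 2 t.numNodes := by omega
          have hpos : 0 < t.numNodes := Nat.pos_of_ne_zero fun h => by simp [h] at hz
          have h2 : t.numNodes ≤ t.numNodes * Nat.log 2 t.numNodes :=
            Nat.le_mul_of_pos_right _ hz
          calc (2 * t.numNodes + 1) * (t.height + 1) + t.numNodes
              ≤ (3 * t.numNodes) * (5 * Nat.log 2 t.numNodes) +
                  t.numNodes * Nat.log 2 t.numNodes := by gcongr; omega
            _ = 16 * (t.numNodes * Nat.log 2 t.numNodes) := by ring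
            _ ≤ _ := by omega
      exact .mono (.opThen rfl (.callThen rfl rfl hev (.call rfl rfl hev'))) (by omega)

theorem evalsWithin_main_prod {Y : Set B} {s : BinaryTree (Orb B)}
    (hX : IsOrbitFiniteNominal X) (ht : IsTreeOf orbitOf X t)
    (hY : IsOrbitFiniteNominal Y) (hs : IsTreeOf orbitOf Y s) :
    ∃ r, IsTreeOf prodOrbitOf (X ×ˢ Y) r ∧
      EvalsWithin U funTable [setVal .orbA t, setVal .orbB s] Main.prod (setVal prodOrbVal r)
        (1000 * (1 + numOrbits (X ×ˢ Y))) := by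
  set l := (inorder t).flatMap fun o => (inorder s).flatMap (prodKeys o) with hl
  have hsorted : l.Pairwise (· < ·) := pairwise_flatMap_prodKeys ht.sorted hs.sorted
  have hmem : ∀ k, k ∈ l ↔ ∃ z ∈ X ×ˢ Y, prodOrbitOf z = k :=
    mem_flatMap_prodKeys hX hY ht.mem_inorder hs.mem_inorder
  have hnum : numOrbits (X ×ˢ Y) = l.length := by
    rw [numOrbits_prod hX hY, length_eq_ncard hsorted hmem]
    rfl
  have htree : ∀ r : BinaryTree (ProdOrb A B), inorder r = l →
      2 ^ r.height ≤ (r.numNodes + 1) ^ 2 → IsTreeOf prodOrbitOf (X ×ˢ Y) r := fun r hr hb =>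
    ⟨hr ▸ hsorted, hb, hr ▸ hmem, by rw [← length_inorder, hr, hnum]⟩
  rcases Nat.eq_zero_or_pos s.numNodes with h0 | hpos
  · have hnil : inorder s = [] := List.length_eq_zero_iff.1 ((length_inorder s).trans h0)
    refine ⟨.nil, htree _ (by simp [hl, hnil, inorder]) (by simp), ?_⟩
    exact .mono (.opThen rfl (.opThen rfl (.opThen rfl (.iteTrue rfl (decide_eq_true h0.le)
      (.opThen rfl (.op rfl)))))) (by omega)
  · have hev := evalsWithin_prod (U := U) t hpos []
    rw [List.append_nil, ← hl] at hev
    obtain ⟨r, hr, hb, hev'⟩ := evalsWithin_mkSet (U := U) (e := prodOrbVal) l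
    refine ⟨r, htree r hr hb, ?_⟩
    rw [hnum]
    exact .mono (.opThen rfl (.opThen rfl (.opThen rfl (.iteFalse rfl
      (decide_eq_false (by omega)) (.opThen rfl (.opThen rfl (.opThen rfl
      (.callThen rfl rfl hev (.call rfl rfl hev'))))))))) (by omega)

end Programs

end Trees

open Classical in
/-- The time bounds are uniform: the programs and the constant `C` depend on nothing. -/
theorem theorem8p1 :
    ∃ (test incl union inter filt image prod : Program) (C : ℕ),
    ∀ (A : Type*) (B : Type*) [MulAction MonoAut A] [MulAction MonoAut B]
      [LinearOrder (Orb A)] [LinearOrder (Orb B)] (U : UserFns A B)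
      (X : Set A) (t : BinaryTree (Orb A)),
      IsOrbitFiniteNominal X → IsTreeOf orbitOf X t →
      -- test `x ∈ X`
      (∀ x : A, ∃ n, Runs U test [.eltA x, setVal .orbA t] (.bool (decide (x ∈ X))) n ∧
        n ≤ C * (1 + Nat.log 2 (numOrbits X))) ∧
      (∀ (Y : Set A) (s : BinaryTree (Orb A)),
        IsOrbitFiniteNominal Y → IsTreeOf orbitOf Y s →
        -- test `X ⊆ Y`
        (∃ n, Runs U incl [setVal .orbA t, setVal .orbA s] (.bool (decide (X ⊆ Y))) n ∧
          n ≤ C * (1 + min (numOrbits X + numOrbits Y)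
            (numOrbits X * Nat.log 2 (numOrbits Y)))) ∧
        -- calculate `X ∪ Y`
        (∃ r n, IsTreeOf orbitOf (X ∪ Y) r ∧
          Runs U union [setVal .orbA t, setVal .orbA s] (setVal .orbA r) n ∧
          n ≤ C * (1 + (numOrbits X + numOrbits Y))) ∧
        -- calculate `X ∩ Y`
        (∃ r n, IsTreeOf orbitOf (X ∩ Y) r ∧
          Runs U inter [setVal .orbA t, setVal .orbA s] (setVal .orbA r) n ∧
          n ≤ C * (1 + (numOrbits X + numOrbits Y)))) ∧
      -- calculate `{x ∈ X | p x}`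
      (∀ p : X → Bool, (∀ (g : MonoAut) (x y : X), (y : A) = g • (x : A) → p y = p x) →
        (∀ x : X, U.pred x = some (p x)) →
        ∃ r n, IsTreeOf orbitOf {x : A | ∃ h : x ∈ X, p ⟨x, h⟩ = true} r ∧
          Runs U filt [setVal .orbA t] (setVal .orbA r) n ∧
          n ≤ C * (1 + numOrbits X)) ∧
      -- calculate `{f x | x ∈ X}`
      (∀ f : X → B, (∀ (g : MonoAut) (x y : X), (y : A) = g • (x : A) → f y = g • f x) →
        (∀ x : X, U.fn x = some (f x)) →
        ∃ r n, IsTreeOf orbitOf (Set.range f) r ∧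
          Runs U image [setVal .orbA t] (setVal .orbB r) n ∧
          n ≤ C * (1 + numOrbits X * Nat.log 2 (numOrbits X))) ∧
      -- calculate `X × Y`, and bound its number of orbits
      (∀ (Y : Set B) (s : BinaryTree (Orb B)),
        IsOrbitFiniteNominal Y → IsTreeOf orbitOf Y s →
        IsOrbitFiniteNominal (X ×ˢ Y) ∧
        (∃ r n, IsTreeOf prodOrbitOf (X ×ˢ Y) r ∧
          Runs U prod [setVal .orbA t, setVal .orbB s] (setVal prodOrbVal r) n ∧
          n ≤ C * (1 + numOrbits (X ×ˢ Y))) ∧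
        numOrbits (X ×ˢ Y) ≤ 3 ^ (setDim X + setDim Y) * (numOrbits X * numOrbits Y)) := by
  refine ⟨⟨funTable, Main.test⟩, ⟨funTable, Main.incl⟩, ⟨funTable, Main.union⟩,
    ⟨funTable, Main.inter⟩, ⟨funTable, Main.filter⟩, ⟨funTable, Main.image⟩,
    ⟨funTable, Main.prod⟩, 10000, ?_⟩
  intro A B _ _ _ _ U X t hX ht
  refine ⟨fun x => ?_, fun Y s hY hs => ⟨?_, ?_, ?_⟩, fun p hp hU => ?_, fun f hf hU => ?_,
    fun Y s hY hs => ⟨hX.prod hY, ?_, numOrbits_prod_le hX hY⟩⟩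
  · exact (evalsWithin_test hX ht x).mono (by omega)
  · exact (evalsWithin_incl hX ht hY hs).mono (by omega)
  · obtain ⟨r, hr, hev⟩ := evalsWithin_main_union (U := U) ht hs
    obtain ⟨n, hn, hle⟩ := hev.mono (N := 10000 * (1 + (numOrbits X + numOrbits Y))) (by omega)
    exact ⟨r, n, hr, hn, hle⟩
  · obtain ⟨r, hr, hev⟩ := evalsWithin_main_inter (U := U) hX ht hs
    obtain ⟨n, hn, hle⟩ := hev.mono (N := 10000 * (1 + (numOrbits X + numOrbits Y))) (by omega)
    exact ⟨r, n, hr, hn, hle⟩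
  · obtain ⟨r, hr, hev⟩ := evalsWithin_main_filter hX ht p hp hU
    obtain ⟨n, hn, hle⟩ := hev.mono (N := 10000 * (1 + numOrbits X)) (by omega)
    exact ⟨r, n, hr, hn, hle⟩
  · obtain ⟨r, hr, n, hn, hle⟩ := evalsWithin_main_image hX ht f hf hU
    exact ⟨r, n, hr, hn, hle⟩
  · obtain ⟨r, hr, hev⟩ := evalsWithin_main_prod (U := U) hX ht hY hs
    obtain ⟨n, hn, hle⟩ := hev.mono (N := 10000 * (1 + numOrbits (X ×ˢ Y))) (by omega)
    exact ⟨r, n, hr, hn, hle⟩
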